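/- For $d\ge 1$ and even $n$, a $(d+1)$-colourful graph on $[n]=\{1,\dots,n\}$ is a bipartite $(d+1)$-regular multigraph on the vertex set $[n]$ whose edges are coloured with the colours $1,\dots,d+1$ in such a way that each vertex is incident to all colours (hence to exactly one edge of each colour). Fix a bipartition of its vertices into white and black ones. For a set $I=\{i<j<k\}$ of three colours, let $G_I$ be the graph on $[n]$ formed by the edges of $G$ whose colour lies in $I$, embedded in an oriented surface by the rotation system in which the clockwise order of the edges is $(i,j,k)$ around white vertices and $(i,k,j)$ around black vertices; $G_I$ is called planar if each connected component of this embedded graph has genus $0$, that is, satisfies $V-E+F=2$ (this does not depend on the chosen bipartition). Let $H_d(n)$ be the number of $(d+1)$-colourful graphs $G$ on $[n]$ such that $G_I$ is planar for every set $I$ of three colours, and let $$\beta_d=\limsup_{\substack{n\to\infty\\ n\ \mathrm{even}}}\frac{\log\left(H_d(n)/n!\right)}{n\log n}.$$ Then $\beta_3=\frac16$, and for every integer $d\ge 4$, $$\frac16\le\beta_d\le\frac{d-2}{6}.$$ -/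

import Mathlib

open Filter

/-- A rotation system (combinatorial map) on a type `D` of half-edges: `rot` sends a half-edge to
the next one in clockwise order around its vertex, and `opp` exchanges the two halves of each edge.
It encodes a graph embedded in a closed oriented surface: the vertices, edges and faces are
the cycles of `rot`, `opp` and `rot * opp` respectively. -/
structure RotationSystem (D : Type*) where
  rot : Equiv.Perm D
  opp : Equiv.Perm D
  opp_opp : ∀ x, opp (opp x) = x
  opp_ne : ∀ x, opp x ≠ x

namespace RotationSystem

variable {D : Type*}

/-- The set of half-edges of the connected component that contains the half-edge `x`. -/
def component (M : RotationSystem D) (x : D) : Set D :=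
  MulAction.orbit (Subgroup.closure {M.rot, M.opp} : Subgroup (Equiv.Perm D)) x

/-- The number of cycles of the permutation `p` (fixed points included) that meet `S`. -/
noncomputable def numCycles (p : Equiv.Perm D) (S : Set D) : ℕ :=
  ((fun x => {y | p.SameCycle x y}) '' S).ncard

/-- The Euler characteristic `V - E + F` of the surface that carries the component of `x`. -/
noncomputable def eulerChar (M : RotationSystem D) (x : D) : ℤ :=
  (numCycles M.rot (M.component x) : ℤ) - numCycles M.opp (M.component x)
    + numCycles (M.rot * M.opp) (M.component x)

/-- An embedded graph is planar if each of its connected components is embedded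
in a sphere, the closed oriented connected surface of Euler characteristic `2`. -/
def IsPlanar (M : RotationSystem D) : Prop :=
  ∀ x, M.eulerChar x = 2

end RotationSystem

/-- A `(d+1)`-colourful graph on `n` labelled vertices: a bipartite `(d+1)`-regular multigraph with
edges coloured by `d + 1` colours, such that every vertex is incident to all colours.
Thus every vertex `v` is incident to exactly one edge of each colour `c`, and such a graph is given
by the other endpoint `nbr c v` of that edge. (Bipartiteness excludes loops.) -/
@[ext]
structure ColourfulGraph (d n : ℕ) where
  nbr : Fin (d + 1) → Fin n → Fin n
  nbr_nbr : ∀ c v, nbr c (nbr c v) = v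
  bipartite : ∃ white : Fin n → Bool, ∀ c v, white (nbr c v) ≠ white v

namespace ColourfulGraph

variable {d n : ℕ}

instance : Finite (ColourfulGraph d n) :=
  Finite.of_injective (fun G => G.nbr) fun _ _ h => ColourfulGraph.ext h

/-- `white` is the indicator of one of the two parts of a bipartition of `G`. -/
def IsBipartition (G : ColourfulGraph d n) (white : Fin n → Bool) : Prop :=
  ∀ c v, white (G.nbr c v) ≠ white v

/-- The subgraph of `G` formed by the edges whose colour is in `I`, with the colours relabelled
in increasing order. -/
def restrict (G : ColourfulGraph d n) {m : ℕ} (I : Finset (Fin (d + 1))) (hI : I.card = m + 1) :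
    ColourfulGraph m n where
  nbr c := G.nbr (I.orderEmbOfFin hI c)
  nbr_nbr _ v := G.nbr_nbr _ v
  bipartite := G.bipartite.imp fun _ h _ v => h _ v

/-- The canonical embedding of a `3`-colourful graph: the edges around a white vertex are, in
clockwise order, those of colours `0, 1, 2`, and around a black vertex those of colours `0, 2, 1`.
The half-edge `(v, c)` is the half at the vertex `v` of the edge of colour `c` at `v`. -/
def canonicalEmbedding (G : ColourfulGraph 2 n) (white : Fin n → Bool)
    (hw : G.IsBipartition white) : RotationSystem (Fin n × Fin 3) where
  rot :=
    { toFun := fun x => (x.1, if white x.1 then x.2 + 1 else x.2 - 1)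
      invFun := fun x => (x.1, if white x.1 then x.2 - 1 else x.2 + 1)
      left_inv := by rintro ⟨v, c⟩; by_cases h : white v <;> simp [h]
      right_inv := by rintro ⟨v, c⟩; by_cases h : white v <;> simp [h] }
  opp :=
    { toFun := fun x => (G.nbr x.2 x.1, x.2)
      invFun := fun x => (G.nbr x.2 x.1, x.2)
      left_inv := by rintro ⟨v, c⟩; simp [G.nbr_nbr]
      right_inv := by rintro ⟨v, c⟩; simp [G.nbr_nbr] }
  opp_opp := by rintro ⟨v, c⟩; simp [G.nbr_nbr]
  opp_ne := by
    rintro ⟨v, c⟩ h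
    exact hw c v (congrArg (fun x : Fin n × Fin 3 => white x.1) h)

/-- Every `3`-coloured subgraph of `G`, with its canonical embedding, is planar. (Exchanging
white and black on a connected component only reverses its orientation, so that the choice of the
bipartition is irrelevant.) -/
def IsThreePlanar (G : ColourfulGraph d n) : Prop :=
  ∃ (white : Fin n → Bool) (hw : G.IsBipartition white),
    ∀ (I : Finset (Fin (d + 1))) (hI : I.card = 2 + 1),
      ((G.restrict I hI).canonicalEmbedding white fun _ v => hw _ v).IsPlanar

end ColourfulGraph

/-- The number `H_d(n)` of `(d+1)`-colourful graphs on `n` labelled vertices all of whose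
`3`-coloured subgraphs are planar. -/
noncomputable def numThreePlanar (d n : ℕ) : ℕ :=
  {G : ColourfulGraph d n | G.IsThreePlanar}.ncard

/-- The growth constant `β_d = limsup log (H_d(n) / n!) / (n log n)`, where `n` tends to infinity
along the even numbers (there are no colourful graphs on an odd number of vertices). -/
noncomputable def growthConst (d : ℕ) : EReal :=
  limsup (fun n : ℕ =>
      ((Real.log ((numThreePlanar d n : ℝ) / (n.factorial : ℝ)) / ((n : ℝ) * Real.log n) : ℝ) : EReal))
    (atTop ⊓ 𝓟 {n : ℕ | Even n})

/-!
The vertices of a colourful graph on `n` vertices are half white, half black. For colours `a, b`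
the permutation `whitePerm a b` of the white vertices (black vertices are fixed) has the bicoloured
`a, b`-cycles as its cycles, and `whitePerm a b * whitePerm b c = whitePerm a c`. Write `ℓ a b` for
the Cayley length `n - cycleCount (whitePerm a b)`. Summing the Euler characteristics of the
components shows that planarity of the colours `a, b, c` means `ℓ a b + ℓ b c + ℓ a c = n - 2 κ`,
where `κ` is the number of components of the subgraph with these colours.

*Upper bound.* Permutations of length at most `r` number at most `2 ^ n * n ^ r`
(`card_filter_cycleCount_le`). Given `x = whitePerm a b`, the permutation `y = whitePerm b c` is one
of few: multiplying `x` by a permutation `ρ` of length `r`, and `y` by `ρ⁻¹`, merges the cycles of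
`x` into the components of the triple (`exists_merge`), where
`2 r = ℓ b c + ℓ a c - ℓ a b`. After this, planarity says that `y` lies on a geodesic of the Cayley
graph, and the geodesics below a permutation are counted by products of Catalan numbers
(`card_geodesicSet_le`), hence at most `4 ^ n`. So there are `n ^ r` choices for `y`, up to an
exponential factor (`card_planarPartners_le`). Up to such factors the number of graphs is therefore
at most `n` to the power `n / 2 + ℓ a b + ∑ c, (ℓ b c + ℓ a c - ℓ a b) / 2`. Each triple of colours
satisfies `ℓ a b + ℓ b c + ℓ a c ≤ n`, and averaging over the pairs `a, b`
(`exists_pair_of_triples_le`) produces a pair for which this exponent is at most `(d + 4) n / 6`,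
which is `n + (d - 2) n / 6`.

*Lower bound.* A prism with a cycle of length `2 L` as its base, coloured `2, 3` along the two bases
and with doubled rungs of colours `0, 1`, is a `4`-colourful graph. Removing every other vertex of
one base leaves `3 L` vertices and `L` slots with four dangling edges each. Two such rings, the
second with the roles of the colours and of white and black exchanged, can be glued along any
permutation of the slots, and the `3`-coloured subgraphs stay connected and planar
(`isPlanar_of_glued`): the bicoloured cycles with colours `0, 1` or `2, 3` are `L + 2` in number, all
others are hexagons. A labelled glued graph determines the gluing up to `n ^ 2` choices
(`gluedGraph_injective`), so with `n = 6 L` there are at least `n ! * L ! / n ^ 2` graphs. Repeating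
the last colour preserves planarity (`isPlanar_of_nbr_eq`), which gives all `d ≥ 3`.
-/

/-! ### Counting cycles of permutations -/

open Equiv RotationSystem

theorem Set.ncard_image_eq_of_iff {α β γ : Type*} {f : α → β} {g : α → γ} {S : Set α}
    (h : ∀ x ∈ S, ∀ y ∈ S, f x = f y ↔ g x = g y) : (f '' S).ncard = (g '' S).ncard := by
  classical
  rcases S.eq_empty_or_nonempty with rfl | ⟨s, hs⟩
  · simp
  have : Nonempty α := ⟨s⟩
  have hmem : ∀ x ∈ S, Function.invFunOn f S (f x) ∈ S ∧ f (Function.invFunOn f S (f x)) = f x :=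
    fun x hx => ⟨Function.invFunOn_mem ⟨x, hx, rfl⟩, Function.invFunOn_eq ⟨x, hx, rfl⟩⟩
  have hval : ∀ x ∈ S, g (Function.invFunOn f S (f x)) = g x := fun x hx =>
    (h _ (hmem x hx).1 _ hx).1 (hmem x hx).2
  have himg : g '' S = (fun c => g (Function.invFunOn f S c)) '' (f '' S) := by
    rw [Set.image_image]
    exact Set.image_congr fun x hx => (hval x hx).symm
  rw [himg]
  refine (Set.InjOn.ncard_image ?_).symm
  rintro _ ⟨x, hx, rfl⟩ _ ⟨y, hy, rfl⟩ hxy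
  simp only [hval x hx, hval y hy] at hxy
  exact (h x hx y hy).2 hxy

theorem setOf_sameCycle_eq_iff {D : Type*} {p : Perm D} {x y : D} :
    {z | p.SameCycle x z} = {z | p.SameCycle y z} ↔ p.SameCycle x y := by
  constructor
  · intro h
    have : y ∈ {z | p.SameCycle y z} := Perm.SameCycle.refl p y
    rw [← h] at this
    exact this
  · intro h
    ext z
    exact ⟨fun hz => h.symm.trans hz, fun hz => h.trans hz⟩

/-- Cycles can be counted with any function that separates exactly the cycles. -/
theorem numCycles_eq_ncard_image {D ι : Type*} {p : Perm D} {S : Set D} {f : D → ι}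
    (hf : ∀ x ∈ S, ∀ y ∈ S, f x = f y ↔ p.SameCycle x y) :
    numCycles p S = (f '' S).ncard :=
  Set.ncard_image_eq_of_iff fun x hx y hy => setOf_sameCycle_eq_iff.trans (hf x hx y hy).symm

/-- A function invariant under `p` is constant on the cycles of `p`. -/
theorem Equiv.Perm.SameCycle.eq_of_invariant {D ι : Type*} {p : Perm D} {f : D → ι}
    (hf : ∀ x, f (p x) = f x) {x y : D} (h : p.SameCycle x y) : f x = f y := by
  obtain ⟨k, rfl⟩ := h
  have hinv : ∀ x, f (p⁻¹ x) = f x := fun x => by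
    rw [← hf (p⁻¹ x), ← Perm.mul_apply, mul_inv_cancel, Perm.one_apply]
  induction k with
  | zero => simp
  | succ k ih => rw [add_comm, zpow_add, zpow_one, Perm.mul_apply, hf, ih]
  | pred k ih => rw [sub_eq_add_neg, add_comm, zpow_add, zpow_neg_one, Perm.mul_apply, hinv, ih]

/-- If every step of `p` stays in a single cycle of `q`, the cycles of `q` are unions of those
of `p`. -/
theorem Equiv.Perm.SameCycle.of_step {D : Type*} {p q : Perm D}
    (h : ∀ x, q.SameCycle x (p x)) {x y : D} (hxy : p.SameCycle x y) : q.SameCycle x y :=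
  setOf_sameCycle_eq_iff.1 <| hxy.eq_of_invariant (f := fun x => {z | q.SameCycle x z})
    fun x => setOf_sameCycle_eq_iff.2 (h x).symm

theorem numCycles_eq_one {D : Type*} {p : Perm D} {S : Set D} (hS : S.Nonempty)
    (h : ∀ x ∈ S, ∀ y ∈ S, p.SameCycle x y) : numCycles p S = 1 := by
  rw [numCycles_eq_ncard_image (f := fun _ => ()) fun x hx y hy => by simpa using h x hx y hy]
  simp [hS.image_const]

theorem numCycles_inv {D : Type*} (p : Perm D) (S : Set D) :
    numCycles p⁻¹ S = numCycles p S := by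
  rw [numCycles, numCycles]
  simp only [Perm.sameCycle_inv]

section CycleCount

variable {α : Type*}

/-- The number of cycles of a permutation, fixed points included. -/
noncomputable def cycleCount (p : Perm α) : ℕ :=
  numCycles p Set.univ

theorem cycleCount_eq_ncard_range {ι : Type*} {p : Perm α} {f : α → ι}
    (hf : ∀ x y, f x = f y ↔ p.SameCycle x y) : cycleCount p = (Set.range f).ncard := by
  rw [cycleCount, numCycles_eq_ncard_image fun x _ y _ => hf x y, Set.image_univ]

theorem cycleCount_congr {p q : Perm α} (h : ∀ x y, p.SameCycle x y ↔ q.SameCycle x y) :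
    cycleCount p = cycleCount q := by
  rw [cycleCount_eq_ncard_range (p := p) (f := fun x => {z | q.SameCycle x z})]
  · rw [cycleCount_eq_ncard_range (p := q) fun x y => setOf_sameCycle_eq_iff]
  · intro x y
    rw [h, setOf_sameCycle_eq_iff]

theorem cycleCount_inv (p : Perm α) : cycleCount p⁻¹ = cycleCount p :=
  cycleCount_congr fun _ _ => Perm.sameCycle_inv

variable [Fintype α]

theorem cycleCount_le_card (p : Perm α) : cycleCount p ≤ Fintype.card α := by
  rw [cycleCount, numCycles, ← Nat.card_eq_fintype_card, ← Set.ncard_univ]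
  exact Set.ncard_image_le

theorem cycleCount_one : cycleCount (1 : Perm α) = Fintype.card α := by
  rw [cycleCount_eq_ncard_range (f := id) (by simp), Set.range_id, Set.ncard_univ,
    Nat.card_eq_fintype_card]

/-- A permutation whose cycles are coarser has fewer cycles. -/
theorem cycleCount_le_of_sameCycle {p q : Perm α}
    (h : ∀ x y, p.SameCycle x y → q.SameCycle x y) : cycleCount q ≤ cycleCount p := by
  have hr : Set.range (fun x => {z | q.SameCycle x z})
      = (fun c : Set α => {z | ∃ x ∈ c, q.SameCycle x z}) ''
        Set.range (fun x => {z | p.SameCycle x z}) := by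
    rw [← Set.range_comp]
    congr 1
    ext x z
    exact ⟨fun hz => ⟨x, Perm.SameCycle.refl p x, hz⟩,
      fun ⟨y, hy, hz⟩ => (h _ _ hy).trans hz⟩
  rw [cycleCount_eq_ncard_range fun x y => setOf_sameCycle_eq_iff (p := q),
    cycleCount_eq_ncard_range fun x y => setOf_sameCycle_eq_iff (p := p), hr]
  exact Set.ncard_image_le (Set.toFinite _)

variable [DecidableEq α]

/-- A transposition of points on distinct cycles puts these points on a common cycle. -/
theorem sameCycle_mul_swap {p : Perm α} {i j : α} (h : ¬ p.SameCycle i j) :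
    (p * swap i j).SameCycle i j := by
  by_contra hn
  -- the part of the `p`-cycle of `j` visited by the new cycle of `i` would be closed under `p`
  have hstep : ∀ k : ℕ, (p * swap i j).SameCycle i ((p ^ k) (p j)) := by
    intro k
    induction k with
    | zero => exact ⟨1, by simp⟩
    | succ k ih =>
      rw [pow_succ', Perm.mul_apply]
      have h1 : (p ^ k) (p j) ≠ j := fun e => hn (by rwa [e] at ih)
      have h2 : (p ^ k) (p j) ≠ i := fun e => h (by
        have : p.SameCycle j i := ⟨(k : ℤ) + 1, by
          rw [zpow_add, zpow_one, Perm.mul_apply, zpow_natCast, e]⟩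
        exact this.symm)
      refine ih.trans ⟨1, ?_⟩
      rw [zpow_one, Perm.mul_apply, swap_apply_of_ne_of_ne h2 h1]
  have hc : p.SameCycle (p j) j := Perm.sameCycle_apply_left.2 (Perm.SameCycle.refl p j)
  obtain ⟨k, hk⟩ := hc.exists_nat_pow_eq
  have := hstep k
  rw [hk] at this
  exact hn this

/-- Multiplying by a transposition of two points on distinct cycles merges these cycles. -/
theorem cycleCount_mul_swap_of_not_sameCycle {p : Perm α} {i j : α} (h : ¬ p.SameCycle i j) :
    cycleCount (p * swap i j) + 1 = cycleCount p := by
  classical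
  set q := p * swap i j with hq
  have hij : q.SameCycle i j := sameCycle_mul_swap h
  have hτ : ∀ x, q.SameCycle x (swap i j x) := fun x => by
    rcases eq_or_ne x i with rfl | hi
    · simpa using hij
    rcases eq_or_ne x j with rfl | hj
    · simpa using hij.symm
    · rw [swap_apply_of_ne_of_ne hi hj]
  have hpq : ∀ x y, p.SameCycle x y → q.SameCycle x y := fun x y hxy =>
    hxy.of_step fun x => (hτ x).trans ⟨1, by simp [hq]⟩
  let cl : α → Set α := fun x => {z | p.SameCycle x z}
  have hcl : ∀ x y, cl x = cl y ↔ p.SameCycle x y := fun x y => setOf_sameCycle_eq_iff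
  let f : α → Set α := fun x => if p.SameCycle j x then cl i else cl x
  have hfp : ∀ x y, p.SameCycle x y → f x = f y := fun x y hxy => by
    have : p.SameCycle j x ↔ p.SameCycle j y := ⟨fun h => h.trans hxy, fun h => h.trans hxy.symm⟩
    simp only [f, this]
    split_ifs
    · rfl
    · exact (hcl x y).2 hxy
  have hfij : f i = f j := by
    simp [f, Perm.SameCycle.refl]
  have hf : ∀ x y, f x = f y ↔ q.SameCycle x y := by
    intro x y
    constructor
    · intro hxy
      have key : ∀ x, ∃ z, f x = cl z ∧ q.SameCycle x z := fun x => by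
        by_cases hx : p.SameCycle j x
        · exact ⟨i, by simp [f, hx], (hpq _ _ hx.symm).trans hij.symm⟩
        · exact ⟨x, by simp [f, hx], Perm.SameCycle.refl q x⟩
      obtain ⟨z, hz, hz'⟩ := key x
      obtain ⟨w, hw, hw'⟩ := key y
      rw [hz, hw, hcl] at hxy
      exact (hz'.trans (hpq _ _ hxy)).trans hw'.symm
    · intro hxy
      refine hxy.eq_of_invariant fun x => ?_
      rw [hq, Perm.mul_apply]
      refine (hfp _ _ (Perm.sameCycle_apply_left.2 (Perm.SameCycle.refl p _))).trans ?_
      rcases eq_or_ne x i with rfl | hi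
      · simpa using hfij.symm
      rcases eq_or_ne x j with rfl | hj
      · simpa using hfij
      · rw [swap_apply_of_ne_of_ne hi hj]
  have hrange : Set.range f = Set.range cl \ {cl j} := by
    ext c
    constructor
    · rintro ⟨x, rfl⟩
      by_cases hx : p.SameCycle j x
      · simp only [f, hx, if_true]
        exact ⟨⟨i, rfl⟩, fun e => h ((hcl _ _).1 e)⟩
      · simp only [f, hx, if_false]
        exact ⟨⟨x, rfl⟩, fun e => hx ((hcl _ _).1 e).symm⟩
    · rintro ⟨⟨x, rfl⟩, hx⟩
      have hx' : ¬ p.SameCycle j x := fun e => hx ((hcl _ _).2 e.symm)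
      exact ⟨x, by simp [f, hx']⟩
  rw [cycleCount_eq_ncard_range hf, cycleCount_eq_ncard_range hcl, hrange]
  exact Set.ncard_sdiff_singleton_add_one ⟨j, rfl⟩ (Set.toFinite _)

theorem cycleCount_mul_swap_le (p : Perm α) (i j : α) :
    cycleCount (p * swap i j) ≤ cycleCount p + 1 := by
  by_cases h : (p * swap i j).SameCycle i j
  · refine (cycleCount_le_of_sameCycle fun x y hxy => ?_).trans (Nat.le_succ _)
    refine hxy.of_step fun x => ?_
    have h1 : (p * swap i j).SameCycle x (swap i j x) := by
      rcases eq_or_ne x i with rfl | hi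
      · simpa using h
      rcases eq_or_ne x j with rfl | hj
      · simpa using h.symm
      · rw [swap_apply_of_ne_of_ne hi hj]
    exact h1.trans ⟨1, by simp⟩
  · have := cycleCount_mul_swap_of_not_sameCycle h
    rw [mul_swap_mul_self] at this
    omega

theorem cycleCount_le_mul_swap (p : Perm α) (i j : α) :
    cycleCount p ≤ cycleCount (p * swap i j) + 1 := by
  simpa [mul_swap_mul_self] using cycleCount_mul_swap_le (p * swap i j) i j

/-- Turning a moved point into a fixed point by a transposition creates one more cycle. -/
theorem cycleCount_swap_mul_of_ne {p : Perm α} {i : α} (h : p i ≠ i) :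
    cycleCount (swap i (p i) * p) = cycleCount p + 1 := by
  set q := swap i (p i) * p with hq
  have hqi : q i = i := by simp [hq]
  have hp : p = q * swap i (q⁻¹ (p i)) := by
    have : swap i (p i) * q = q * swap i (q⁻¹ (p i)) := by
      rw [swap_mul_eq_mul_swap]
      congr 2
      rw [Perm.inv_eq_iff_eq, hqi]
    rw [← this, hq, ← mul_assoc, swap_mul_self, one_mul]
  have hns : ¬ q.SameCycle i (q⁻¹ (p i)) := by
    intro hs
    have := hs.eq_of_left hqi
    rw [Perm.eq_inv_iff_eq, hqi] at this
    exact h this.symm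
  rw [← cycleCount_mul_swap_of_not_sameCycle hns, ← hp]

theorem eq_one_of_card_le_cycleCount {p : Perm α} (h : Fintype.card α ≤ cycleCount p) : p = 1 := by
  by_contra hp
  obtain ⟨i, hi⟩ : ∃ i, p i ≠ i := not_forall.1 fun h => hp (Equiv.ext h)
  have := cycleCount_le_card (swap i (p i) * p)
  rw [cycleCount_swap_mul_of_ne hi] at this
  omega

/-- The triangle inequality for the Cayley length `Fintype.card α - cycleCount p`. -/
theorem cycleCount_add_le (p q : Perm α) :
    cycleCount p + cycleCount q ≤ Fintype.card α + cycleCount (p * q) := by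
  induction hk : Fintype.card α - cycleCount q generalizing p q with
  | zero =>
    obtain rfl := eq_one_of_card_le_cycleCount (Nat.sub_eq_zero_iff_le.1 hk)
    rw [mul_one, cycleCount_one, add_comm]
  | succ k ih =>
    have hq : q ≠ 1 := by
      rintro rfl
      simp [cycleCount_one] at hk
    obtain ⟨i, hi⟩ : ∃ i, q i ≠ i := not_forall.1 fun h => hq (Equiv.ext h)
    have h1 := cycleCount_swap_mul_of_ne hi
    have h2 := ih (p * swap i (q i)) (swap i (q i) * q) (by omega)
    have h3 := cycleCount_le_mul_swap p i (q i)
    have h4 : p * swap i (q i) * (swap i (q i) * q) = p * q := by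
      rw [mul_assoc, ← mul_assoc (swap i (q i)), swap_mul_self, one_mul]
    rw [h4] at h2
    omega

/-- There are at most `2 ^ n * n ^ r` permutations of `n` points with at least `n - r` cycles:
each point is either fixed, or fixed after composing with one of `n` transpositions, which
creates a cycle. -/
theorem card_filter_cycleCount_le [Nonempty α] (r : ℕ) :
    (Finset.univ.filter fun ρ : Perm α => Fintype.card α ≤ cycleCount ρ + r).card
      ≤ 2 ^ Fintype.card α * Fintype.card α ^ r := by
  have main : ∀ (S : Finset α) (r : ℕ),
      (Finset.univ.filter fun ρ : Perm α =>
        (∀ v, v ∉ S → ρ v = v) ∧ Fintype.card α ≤ cycleCount ρ + r).card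
        ≤ 2 ^ S.card * Fintype.card α ^ r := by
    intro S
    induction S using Finset.induction_on with
    | empty =>
      intro r
      have hsub : (Finset.univ.filter fun ρ : Perm α =>
          (∀ v, v ∉ (∅ : Finset α) → ρ v = v) ∧ Fintype.card α ≤ cycleCount ρ + r) ⊆
          {1} := by
        intro ρ hρ
        simp only [Finset.mem_filter] at hρ
        exact Finset.mem_singleton.2 (Equiv.ext fun v => hρ.2.1 v (by simp))
      refine (Finset.card_le_card hsub).trans ?_
      rw [Finset.card_singleton]
      exact Nat.one_le_iff_ne_zero.2 (by have := Fintype.card_pos (α := α); positivity)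
    | insert i S hi ih =>
      intro r
      cases r with
      | zero =>
        refine (Finset.card_le_card (t := {1}) ?_).trans ?_
        · intro ρ hρ
          simp only [Finset.mem_filter] at hρ
          exact Finset.mem_singleton.2 (eq_one_of_card_le_cycleCount hρ.2.2)
        · simp [Nat.one_le_two_pow]
      | succ r =>
        have hsub : (Finset.univ.filter fun ρ : Perm α =>
            (∀ v, v ∉ insert i S → ρ v = v) ∧ Fintype.card α ≤ cycleCount ρ + (r + 1)) ⊆
            (Finset.univ.filter fun ρ : Perm α =>
              (∀ v, v ∉ S → ρ v = v) ∧ Fintype.card α ≤ cycleCount ρ + (r + 1)) ∪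
            ((Finset.univ : Finset α) ×ˢ (Finset.univ.filter fun ρ : Perm α =>
              (∀ v, v ∉ S → ρ v = v) ∧ Fintype.card α ≤ cycleCount ρ + r)).image
              fun x => swap i x.1 * x.2 := by
          intro ρ hρ
          simp only [Finset.mem_filter, Finset.mem_univ, true_and] at hρ
          rw [Finset.mem_union]
          by_cases hρi : ρ i = i
          · left
            simp only [Finset.mem_filter, Finset.mem_univ, true_and]
            refine ⟨fun v hv => ?_, hρ.2⟩
            rcases eq_or_ne v i with rfl | hvi
            · exact hρi
            · exact hρ.1 v (by simp [hvi, hv])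
          · right
            simp only [Finset.mem_image, Finset.mem_product, Finset.mem_filter, Finset.mem_univ,
              true_and]
            refine ⟨(ρ i, swap i (ρ i) * ρ), ⟨fun v hv => ?_, ?_⟩, ?_⟩
            · rcases eq_or_ne v i with rfl | hvi
              · simp
              · have hv' : ρ v = v := hρ.1 v (by simp [hvi, hv])
                have : v ≠ ρ i := fun e => hvi (ρ.injective (hv'.trans e))
                rw [Perm.mul_apply, hv', swap_apply_of_ne_of_ne hvi this]
            · rw [cycleCount_swap_mul_of_ne hρi]
              omega
            · simp [← mul_assoc]
        refine (Finset.card_le_card hsub).trans <| (Finset.card_union_le _ _).trans ?_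
        refine (add_le_add (ih (r + 1)) (Finset.card_image_le.trans_eq
          (Finset.card_product _ _))).trans ?_
        rw [Finset.card_insert_of_notMem hi, Finset.card_univ]
        calc _ ≤ 2 ^ S.card * Fintype.card α ^ (r + 1)
              + Fintype.card α * (2 ^ S.card * Fintype.card α ^ r) := by
              gcongr
              exact ih r
          _ = _ := by ring
  simpa using main Finset.univ r

end CycleCount

/-! ### Geodesics of the Cayley graph and Catalan numbers -/

section Geodesic

variable {α : Type*} [DecidableEq α]

/-- Two cycles with one common point, the last of `l ++ [a]` and the first of `a :: l'`, multiply to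
a single cycle. -/
theorem List.formPerm_append_cons (l : List α) (a : α) (l' : List α) :
    (l ++ a :: l').formPerm = (l ++ [a]).formPerm * (a :: l').formPerm := by
  induction l with
  | nil => simp
  | cons b l ih =>
    cases l with
    | nil => simp
    | cons c l =>
      simp only [List.cons_append, List.formPerm_cons_cons] at ih ⊢
      rw [ih, mul_assoc]

theorem List.formPerm_cons_eq_formPerm_append {a : α} {l : List α} (h : (a :: l).Nodup) :
    (a :: l).formPerm = (l ++ [a]).formPerm := by
  rw [← List.formPerm_rotate_one _ h]
  simp

/-- Cutting a cycle in two by a transposition. -/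
theorem formPerm_cons_append_mul_swap {p q : α} {l l' : List α}
    (h : (p :: (l ++ q :: l')).Nodup) :
    (p :: (l ++ q :: l')).formPerm * swap p q
      = (l ++ [q]).formPerm * (p :: l').formPerm := by
  have h1 : (p :: (l ++ q :: l')).formPerm
      = (p :: (l ++ [q])).formPerm * (q :: l').formPerm :=
    List.formPerm_append_cons (p :: l) q l'
  have hn : (p :: (l ++ [q])).Nodup := by
    refine h.sublist ?_
    simp
  have hp : p ∉ l' ∧ p ≠ q := by
    simp only [List.nodup_cons, List.mem_append, List.mem_cons] at h
    tauto
  have hq : q ∉ l' := by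
    have := (List.nodup_append.1 (List.nodup_cons.1 h).2).2.1
    exact (List.nodup_cons.1 this).1
  have h2 : (q :: l').formPerm * swap p q = swap p q * (p :: l').formPerm := by
    cases l' with
    | nil => simp
    | cons b l' =>
      have hb : b ≠ p ∧ b ≠ q := by
        simp only [List.mem_cons, not_or] at hp hq
        exact ⟨Ne.symm hp.1.1, Ne.symm hq.1⟩
      have hc : Commute (b :: l').formPerm (swap p q) := by
        refine (Perm.Disjoint.commute fun x => ?_)
        by_cases hx : x ∈ b :: l'
        · right
          exact swap_apply_of_ne_of_ne (fun e => hp.1 (e ▸ hx)) (fun e => hq (e ▸ hx))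
        · exact Or.inl (List.formPerm_apply_of_notMem hx)
      rw [List.formPerm_cons_cons, List.formPerm_cons_cons, mul_assoc, hc.eq, ← mul_assoc,
        ← mul_assoc]
      congr 1
      rw [swap_mul_eq_mul_swap, swap_inv, swap_apply_right, swap_apply_of_ne_of_ne hb.1 hb.2]
  rw [h1, List.formPerm_cons_eq_formPerm_append hn, List.append_assoc, List.singleton_append,
    List.formPerm_append_pair, mul_assoc, h2, ← mul_assoc, mul_assoc _ (swap q p),
    swap_comm q p, swap_mul_self, mul_one]

/-- The product of the cycles given by a list of lists. -/
def cyclesPerm : List (List α) → Perm α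
  | [] => 1
  | l :: L => cyclesPerm L * l.formPerm

theorem cyclesPerm_apply_of_notMem {L : List (List α)} {p : α} (h : p ∉ L.flatten) :
    cyclesPerm L p = p := by
  induction L with
  | nil => rfl
  | cons l L ih =>
    rw [List.flatten_cons, List.mem_append, not_or] at h
    rw [cyclesPerm, Perm.mul_apply, List.formPerm_apply_of_notMem h.1, ih h.2]

/-- Multiplying by the transposition of `p` and `q` cuts the first cycle after `q`. -/
theorem cyclesPerm_split {L : List (List α)} {p q : α} {l l' : List α}
    (h : (p :: (l ++ q :: l')).Nodup) :
    cyclesPerm ((p :: (l ++ q :: l')) :: L) * swap p q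
      = cyclesPerm ((p :: l') :: (l ++ [q]) :: L) := by
  simp only [cyclesPerm]
  rw [mul_assoc, formPerm_cons_append_mul_swap h, mul_assoc]

/-- Moving a transposition from `y` to `x` does not change the product. -/
theorem mul_swap_mul_swap_mul (x y : Perm α) (i j : α) :
    x * swap i j * (swap i j * y) = x * y := by
  rw [mul_assoc, ← mul_assoc (swap i j), swap_mul_self, one_mul]

variable [Fintype α]

/-- The permutations `y` such that `y⁻¹` lies on a geodesic from `1` to `x` in the Cayley graph
generated by all transpositions. -/
noncomputable def geodesicSet (x : Perm α) : Finset (Perm α) :=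
  Finset.univ.filter fun y => Fintype.card α + cycleCount x ≤ cycleCount y + cycleCount (x * y)

theorem mem_geodesicSet {x y : Perm α} :
    y ∈ geodesicSet x ↔
      Fintype.card α + cycleCount x ≤ cycleCount y + cycleCount (x * y) := by
  simp [geodesicSet]

/-- Points of a geodesic move inside the cycles of its end point: otherwise a transposition would
shorten `y` while lengthening `x`, against the triangle inequality. -/
theorem sameCycle_of_mem_geodesicSet {x y : Perm α} (h : y ∈ geodesicSet x) (i : α) :
    x.SameCycle i (y i) := by
  by_contra hn
  have hi : y i ≠ i := fun e => hn (e.symm ▸ Perm.SameCycle.refl x i)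
  have h1 := cycleCount_mul_swap_of_not_sameCycle hn
  have h2 := cycleCount_swap_mul_of_ne hi
  have h3 := cycleCount_add_le (x * y) (swap i (y i) * y)⁻¹
  rw [cycleCount_inv, ← mul_swap_mul_swap_mul x y i (y i), mul_inv_cancel_right] at h3
  rw [mul_swap_mul_swap_mul] at h3
  rw [mem_geodesicSet] at h
  omega

/-- Cutting along the image of `p`. -/
theorem swap_mul_mem_geodesicSet {x y : Perm α} (h : y ∈ geodesicSet x) {p : α} (hp : y p ≠ p) :
    swap p (y p) * y ∈ geodesicSet (x * swap p (y p)) := by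
  have h1 := cycleCount_mul_swap_le x p (y p)
  have h2 := cycleCount_swap_mul_of_ne hp
  rw [mem_geodesicSet] at h ⊢
  rw [mul_swap_mul_swap_mul]
  omega

/-- Deleting a point `p` fixed by `y` from its cycle in `x`. -/
theorem mem_geodesicSet_of_mul_swap {z y : Perm α} {p b : α} (hz : z p = p) (hy : y p = p)
    (hb : b ≠ p) (h : y ∈ geodesicSet (z * swap b p)) : y ∈ geodesicSet z := by
  have h1 : ¬ z.SameCycle b p := fun e => hb (e.eq_of_right hz)
  have h2 : ¬ (z * y).SameCycle (y⁻¹ b) p := fun e => by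
    have := e.eq_of_right (show (z * y) p = p by rw [Perm.mul_apply, hy, hz])
    rw [Perm.inv_eq_iff_eq, hy] at this
    exact hb this
  have h3 : z * swap b p * y = z * y * swap (y⁻¹ b) p := by
    have : y⁻¹ p = p := by rw [Perm.inv_eq_iff_eq, hy]
    rw [mul_assoc, swap_mul_eq_mul_swap, this, mul_assoc]
  have h4 := cycleCount_mul_swap_of_not_sameCycle h1
  have h5 := cycleCount_mul_swap_of_not_sameCycle h2
  rw [mem_geodesicSet, h3] at h
  rw [mem_geodesicSet]
  omega

theorem mem_geodesicSet_formPerm_of_cons {R y : Perm α} {p : α} {l : List α}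
    (hl : (p :: l).Nodup) (hR : R p = p) (hy : y p = p)
    (h : y ∈ geodesicSet (R * (p :: l).formPerm)) : y ∈ geodesicSet (R * l.formPerm) := by
  rcases List.eq_nil_or_concat l with rfl | ⟨l, b, rfl⟩
  · simpa using h
  · rw [List.formPerm_cons_eq_formPerm_append hl, List.concat_eq_append, List.append_assoc,
      List.singleton_append, List.formPerm_append_pair, ← mul_assoc] at h
    rw [List.nodup_cons] at hl
    rw [List.concat_eq_append] at hl ⊢
    refine mem_geodesicSet_of_mul_swap ?_ hy ?_ h
    · rw [Perm.mul_apply, List.formPerm_apply_of_notMem hl.1, hR]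
    · rintro rfl
      simp at hl

/-- The Catalan recursion: cutting the first cycle of `x` at a chosen point `p` and at its image
under `y` maps the geodesic set of `x` into a union of geodesic sets of smaller permutations. -/
theorem card_geodesicSet_cons_le {p : α} {l : List α} {L : List (List α)}
    (h : ((p :: l) :: L).flatten.Nodup) :
    (geodesicSet (cyclesPerm ((p :: l) :: L))).card ≤
      ∑ s : Fin (l.length + 1),
        (geodesicSet (cyclesPerm (l.drop s :: l.take s :: L))).card := by
  have hl : (p :: l).Nodup := h.sublist (by simp)
  have hpL : p ∉ L.flatten := by
    rw [List.flatten_cons, List.cons_append, List.nodup_cons, List.mem_append] at h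
    tauto
  have hsub : geodesicSet (cyclesPerm ((p :: l) :: L)) ⊆
      Finset.univ.biUnion fun s : Fin (l.length + 1) =>
        (geodesicSet (cyclesPerm (l.drop s :: l.take s :: L))).image
          fun y => swap p ((p :: l)[(s : ℕ)]'s.2) * y := by
    intro y hy
    rw [Finset.mem_biUnion]
    have hmem : y p ∈ p :: l := by
      by_contra hn
      have hs := sameCycle_of_mem_geodesicSet hy p
      have := hs.eq_of_invariant (f := fun v => v ∈ p :: l) fun v => by
        rw [cyclesPerm, Perm.mul_apply, eq_iff_iff]
        by_cases hv : v ∈ p :: l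
        · have hv' := List.formPerm_apply_mem_of_mem hv
          have : (p :: l).formPerm v ∉ L.flatten := by
            rw [List.flatten_cons, List.nodup_append] at h
            exact fun hv'' => h.2.2 _ hv' _ hv'' rfl
          rw [cyclesPerm_apply_of_notMem this]
          exact ⟨fun _ => hv, fun _ => hv'⟩
        · rw [List.formPerm_apply_of_notMem hv]
          refine ⟨fun hv' => ?_, fun hv' => absurd hv' hv⟩
          have : cyclesPerm L v ∉ L.flatten := by
            rw [List.flatten_cons, List.nodup_append] at h
            exact fun hv'' => h.2.2 _ hv' _ hv'' rfl
          have := cyclesPerm_apply_of_notMem this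
          rw [(cyclesPerm L).injective this] at hv'
          exact hv'
      rw [eq_iff_iff] at this
      exact hn (this.1 List.mem_cons_self)
    by_cases hyp : y p = p
    · refine ⟨0, Finset.mem_univ _, ?_⟩
      rw [Finset.mem_image]
      refine ⟨y, ?_, by simp [← Perm.one_def]⟩
      have := mem_geodesicSet_formPerm_of_cons hl (cyclesPerm_apply_of_notMem hpL) hyp hy
      simpa [cyclesPerm] using this
    · have hyl : y p ∈ l := by
        rw [List.mem_cons] at hmem
        tauto
      obtain ⟨l₁, l₂, hl₁₂⟩ := List.append_of_mem hyl
      refine ⟨⟨l₁.length + 1, by simp [hl₁₂]⟩, Finset.mem_univ _, ?_⟩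
      rw [Finset.mem_image]
      have hget : ∀ hs, (p :: l)[l₁.length + 1]'hs = y p := by simp [hl₁₂]
      refine ⟨swap p (y p) * y, ?_, by simp [hget, ← mul_assoc]⟩
      have hy' := swap_mul_mem_geodesicSet hy hyp
      have hl' := hl
      rw [hl₁₂] at hl'
      rw [hl₁₂, cyclesPerm_split hl', cyclesPerm] at hy'
      have hnd : (p :: l₂).Nodup := hl'.sublist (by simp)
      have hp₁ : p ∉ l₁ ++ [y p] := by
        rw [List.nodup_cons] at hl'
        simp only [List.mem_append, List.mem_cons] at hl' ⊢
        tauto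
      have hR : cyclesPerm ((l₁ ++ [y p]) :: L) p = p := by
        rw [cyclesPerm, Perm.mul_apply, List.formPerm_apply_of_notMem hp₁,
          cyclesPerm_apply_of_notMem hpL]
      have := mem_geodesicSet_formPerm_of_cons hnd hR (by simp) hy'
      have ht : l.take (l₁.length + 1) = l₁ ++ [y p] := by
        simp [hl₁₂, List.take_append]
      have hd : l.drop (l₁.length + 1) = l₂ := by
        simp [hl₁₂, List.drop_append]
      simp only [ht, hd]
      exact this
  refine (Finset.card_le_card hsub).trans (Finset.card_biUnion_le.trans ?_)
  exact Finset.sum_le_sum fun s _ => Finset.card_image_le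

/-- The geodesics below a product of disjoint cycles are at most as many as the families of
noncrossing partitions of these cycles. -/
theorem card_geodesicSet_cyclesPerm_le (L : List (List α)) (h : L.flatten.Nodup) :
    (geodesicSet (cyclesPerm L)).card ≤ (L.map fun l => catalan l.length).prod := by
  induction hN : 2 * L.flatten.length + L.length using Nat.strong_induction_on generalizing L with
  | _ N ih =>
    rcases L with _ | ⟨_ | ⟨p, l⟩, L⟩
    · have : geodesicSet (cyclesPerm ([] : List (List α))) ⊆ {1} := by
        intro y hy
        rw [mem_geodesicSet, cyclesPerm, one_mul, cycleCount_one] at hy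
        exact Finset.mem_singleton.2 (eq_one_of_card_le_cycleCount (by omega))
      simpa using Finset.card_le_card this
    · have := ih (2 * L.flatten.length + L.length) (by simp at hN ⊢; omega) L (by simpa using h) rfl
      simpa [cyclesPerm] using this
    · refine (card_geodesicSet_cons_le h).trans ?_
      rw [List.map_cons, List.prod_cons, List.length_cons, catalan_succ, Finset.sum_mul]
      refine Finset.sum_le_sum fun s _ => ?_
      have hs : (s : ℕ) ≤ l.length := Nat.lt_succ_iff.1 s.2
      refine (ih _ ?_ (l.drop s :: l.take s :: L) ?_ rfl).trans_eq ?_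
      · rw [← hN]
        simp only [List.flatten_cons, List.length_append, List.length_cons, List.length_drop,
          List.length_take]
        omega
      · have hp : (l.drop s ++ l.take s).Perm l := by
          refine List.perm_append_comm.trans ?_
          rw [List.take_append_drop]
        rw [List.flatten_cons, List.flatten_cons, ← List.append_assoc]
        rw [(hp.append_right L.flatten).nodup_iff]
        rw [List.flatten_cons, List.cons_append, List.nodup_cons] at h
        exact h.2
      · simp only [List.map_cons, List.prod_cons, List.length_drop, List.length_take,
          min_eq_left hs]
        ring

theorem catalan_le_four_pow (n : ℕ) : catalan n ≤ 4 ^ n := by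
  rw [catalan_eq_centralBinom_div]
  refine (Nat.div_le_self _ _).trans ?_
  have := Nat.choose_le_two_pow (2 * n) n
  rw [pow_mul] at this
  exact this

/-- Merging all cycles of `x` only enlarges its geodesic set. -/
theorem exists_nodup_geodesicSet_subset (x : Perm α) :
    ∃ l : List α, l.Nodup ∧ geodesicSet x ⊆ geodesicSet l.formPerm := by
  induction hk : cycleCount x using Nat.strong_induction_on generalizing x with
  | _ k ih =>
    by_cases h : ∀ i j, x.SameCycle i j
    · by_cases hx : x = 1
      · exact ⟨[], List.nodup_nil, by simp [hx]⟩
      · obtain ⟨i, hi⟩ : ∃ i, x i ≠ i := not_forall.1 fun h => hx (Equiv.ext h)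
        refine ⟨x.toList i, Perm.nodup_toList x i, ?_⟩
        have : x.cycleOf i = x := Equiv.ext fun j => (h i j).cycleOf_apply
        rw [Perm.formPerm_toList, this]
    · push Not at h
      obtain ⟨i, j, hij⟩ := h
      have h1 := cycleCount_mul_swap_of_not_sameCycle hij
      obtain ⟨l, hl, hsub⟩ := ih _ (by omega) (x * swap i j) rfl
      refine ⟨l, hl, fun y hy => hsub ?_⟩
      have h2 := cycleCount_le_mul_swap (x * y) (y⁻¹ i) (y⁻¹ j)
      rw [mem_geodesicSet] at hy ⊢
      rw [mul_assoc x, swap_mul_eq_mul_swap, ← mul_assoc]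
      omega

theorem card_geodesicSet_le (x : Perm α) : (geodesicSet x).card ≤ 4 ^ Fintype.card α := by
  obtain ⟨l, hl, hsub⟩ := exists_nodup_geodesicSet_subset x
  have h := card_geodesicSet_cyclesPerm_le [l] (by simpa using hl)
  simp only [cyclesPerm, one_mul, List.map_cons, List.map_nil, List.prod_cons, List.prod_nil,
    mul_one] at h
  exact (Finset.card_le_card hsub).trans <| h.trans <| (catalan_le_four_pow _).trans <|
    Nat.pow_le_pow_right (by norm_num) hl.length_le_card

end Geodesic

/-! ### Counting planar partners of a permutation -/

section Planar

variable {α : Type*} [Fintype α] [DecidableEq α]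

/-- For permutations `x` and `y`, some `ρ` of small Cayley length merges the cycles of `x` into
the orbits of the group generated by `x` and `y`, while cutting cycles of `y` and keeping the
product `x * y`: as long as some `y i` is not in the cycle of `i` under `x`, multiply by the
transposition of `i` and `y i`. -/
theorem exists_merge (x y : Perm α) :
    ∃ ρ : Perm α, (∀ i, (x * ρ).SameCycle i (x i)) ∧ (∀ i, (x * ρ).SameCycle i (y i)) ∧
      cycleCount (x * ρ) + Fintype.card α ≤ cycleCount x + cycleCount ρ ∧
      cycleCount (x * ρ) + cycleCount (ρ⁻¹ * y) = cycleCount x + cycleCount y := by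
  induction hk : cycleCount x using Nat.strong_induction_on generalizing x y with
  | _ k ih =>
    by_cases h : ∀ i, x.SameCycle i (y i)
    · refine ⟨1, ?_, ?_, ?_, ?_⟩
      · exact fun i => by simpa using Perm.SameCycle.refl x (x i)
      · simpa using h
      · simp [cycleCount_one, hk]
      · simp [hk]
    · push Not at h
      obtain ⟨i, hi⟩ := h
      have hyi : y i ≠ i := fun e => hi (e.symm ▸ Perm.SameCycle.refl x i)
      have h1 := cycleCount_mul_swap_of_not_sameCycle hi
      have h2 := cycleCount_swap_mul_of_ne hyi
      obtain ⟨ρ, hx, hy, hρ, hc⟩ :=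
        ih _ (by omega) (x * swap i (y i)) (swap i (y i) * y) rfl
      have h3 := cycleCount_mul_swap_le ρ⁻¹ i (y i)
      have h4 : (swap i (y i) * ρ)⁻¹ = ρ⁻¹ * swap i (y i) := by
        rw [mul_inv_rev, swap_inv]
      have h5 := cycleCount_le_mul_swap ρ⁻¹ i (y i)
      rw [← h4, cycleCount_inv, cycleCount_inv] at h5
      rw [mul_assoc] at hx hy hρ hc
      have hτ : ∀ j, (x * (swap i (y i) * ρ)).SameCycle j (swap i (y i) j) := by
        have hs : (x * (swap i (y i) * ρ)).SameCycle i (y i) :=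
          (sameCycle_mul_swap hi).of_step hx
        intro j
        rcases eq_or_ne j i with rfl | hji
        · simpa using hs
        by_cases hj : j = y i
        · rw [hj, swap_apply_right]
          exact hs.symm
        · rw [swap_apply_of_ne_of_ne hji hj]
      refine ⟨swap i (y i) * ρ, fun j => ?_, fun j => ?_, by omega, ?_⟩
      · have := hx (swap i (y i) j)
        rw [Perm.mul_apply, swap_apply_self] at this
        exact (hτ j).trans this
      · have := hτ ((swap i (y i) * y) j)
        rw [Perm.mul_apply, swap_apply_self] at this
        exact (hy j).trans this
      · rw [h4, mul_assoc]
        omega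

/-- The permutations `y` for which the merging of cycles ends with a geodesic after a `ρ` of
Cayley length at most `r`. -/
noncomputable def planarPartners (x : Perm α) (r : ℕ) : Finset (Perm α) :=
  (Finset.univ.filter fun ρ : Perm α => Fintype.card α ≤ cycleCount ρ + r).biUnion fun ρ =>
    (geodesicSet (x * ρ)).image fun y => ρ * y

theorem card_planarPartners_le [Nonempty α] (x : Perm α) (r : ℕ) :
    (planarPartners x r).card ≤ 8 ^ Fintype.card α * Fintype.card α ^ r := by
  refine Finset.card_biUnion_le.trans ?_
  calc _ ≤ ∑ ρ ∈ Finset.univ.filter fun ρ : Perm α => Fintype.card α ≤ cycleCount ρ + r,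
        4 ^ Fintype.card α :=
        Finset.sum_le_sum fun ρ _ => Finset.card_image_le.trans (card_geodesicSet_le _)
    _ ≤ (2 ^ Fintype.card α * Fintype.card α ^ r) * 4 ^ Fintype.card α := by
        rw [Finset.sum_const, smul_eq_mul]
        exact Nat.mul_le_mul_right _ (card_filter_cycleCount_le r)
    _ = 8 ^ Fintype.card α * Fintype.card α ^ r := by
        rw [show (8 : ℕ) = 2 * 4 by norm_num, mul_pow]
        ring

theorem mem_planarPartners_zero {x y : Perm α} (h : y ∈ geodesicSet x) :
    y ∈ planarPartners x 0 := by
  simp only [planarPartners, Finset.mem_biUnion, Finset.mem_filter, Finset.mem_univ, true_and,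
    Finset.mem_image]
  exact ⟨1, by simp [cycleCount_one], y, by simpa using h, by simp⟩

/-- If the hypermap `(x, y)` has genus `0` (its number `k` of components being recovered from the
Euler characteristic), then `y` is obtained from a geodesic by a permutation `ρ` whose Cayley
length `r` is the number of cycles of `x` minus the number of components. -/
theorem mem_planarPartners {x y : Perm α} {k r : ℕ}
    (hk : cycleCount x + cycleCount y + cycleCount (x * y) = Fintype.card α + 2 * k)
    (horb : ∀ z : Perm α, (∀ i, z.SameCycle i (x i)) → (∀ i, z.SameCycle i (y i)) →
      cycleCount z ≤ k)
    (hr : cycleCount x = k + r) : y ∈ planarPartners x r := by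
  obtain ⟨ρ, hx, hy, hρ, hc⟩ := exists_merge x y
  have hz := horb _ hx hy
  have hxy : x * ρ * (ρ⁻¹ * y) = x * y := by
    rw [mul_assoc, mul_inv_cancel_left]
  have htri := cycleCount_add_le (x * y) (ρ⁻¹ * y)⁻¹
  rw [← hxy, mul_inv_cancel_right, cycleCount_inv, hxy] at htri
  simp only [planarPartners, Finset.mem_biUnion, Finset.mem_filter, Finset.mem_univ, true_and,
    Finset.mem_image]
  refine ⟨ρ, by omega, ρ⁻¹ * y, ?_, by simp⟩
  rw [mem_geodesicSet, hxy]
  omega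

end Planar

/-! ### Components of a rotation system -/

namespace RotationSystem

variable {D : Type*} (M : RotationSystem D)

theorem mem_component_self (x : D) : x ∈ M.component x := MulAction.mem_orbit_self x

theorem component_eq_of_mem {x y : D} (h : y ∈ M.component x) : M.component y = M.component x :=
  MulAction.orbit_eq_iff.2 h

/-- Components are closed under `rot` and its inverse. -/
theorem rot_mem_component {x y : D} : M.rot y ∈ M.component x ↔ y ∈ M.component x := by
  have : M.rot ∈ Subgroup.closure {M.rot, M.opp} := Subgroup.subset_closure (by simp)
  rw [component, ← MulAction.orbit_eq_iff, ← MulAction.orbit_eq_iff]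
  exact (MulAction.orbit_smul (⟨M.rot, this⟩ : Subgroup.closure {M.rot, M.opp}) y).congr_left

/-- Components are closed under `opp`. -/
theorem opp_mem_component {x y : D} : M.opp y ∈ M.component x ↔ y ∈ M.component x := by
  have : M.opp ∈ Subgroup.closure {M.rot, M.opp} := Subgroup.subset_closure (by simp)
  rw [component, ← MulAction.orbit_eq_iff, ← MulAction.orbit_eq_iff]
  exact (MulAction.orbit_smul (⟨M.opp, this⟩ : Subgroup.closure {M.rot, M.opp}) y).congr_left

/-- A function invariant under `rot` and `opp` is constant on components. -/
theorem eq_of_mem_component {ι : Type*} {f : D → ι} (hrot : ∀ x, f (M.rot x) = f x)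
    (hopp : ∀ x, f (M.opp x) = f x) {x y : D} (h : y ∈ M.component x) : f y = f x := by
  obtain ⟨⟨g, hg⟩, rfl⟩ := h
  change f (g x) = f x
  induction hg using Subgroup.closure_induction generalizing x with
  | mem g hg =>
    rcases hg with rfl | hg
    · exact hrot x
    · rw [Set.mem_singleton_iff.1 hg, hopp]
  | one => rfl
  | mul g h _ _ ihg ihh => rw [Perm.mul_apply, ihg, ihh]
  | inv g _ ih => rw [← ih (x := g⁻¹ x), ← Perm.mul_apply, mul_inv_cancel, Perm.one_apply]


/-- Cycle counts add up over the components. -/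
theorem numCycles_univ_eq_sum [Finite D] {p : Equiv.Perm D}
    (hp : ∀ x, p x ∈ M.component x) :
    (numCycles p Set.univ : ℤ)
      = ∑ᶠ K : Set.range M.component, (numCycles p (K : Set D) : ℤ) := by
  have := Fintype.ofFinite (Set.range M.component)
  have hcl : ∀ x y, p.SameCycle x y → M.component x = M.component y := fun x y h =>
    h.eq_of_invariant fun x => M.component_eq_of_mem (hp x)
  have hU : (Set.univ : Set D) = ⋃ K : Set.range M.component, (K : Set D) := by
    ext x
    simp only [Set.mem_univ, Set.mem_iUnion, true_iff]
    exact ⟨⟨_, x, rfl⟩, M.mem_component_self x⟩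
  rw [hU, numCycles, Set.image_iUnion, Set.ncard_iUnion_of_finite (fun _ => Set.toFinite _)]
  · rw [finsum_eq_sum_of_fintype, finsum_eq_sum_of_fintype]
    push_cast
    rfl
  · rintro ⟨_, a, rfl⟩ ⟨_, b, rfl⟩ hab
    rw [Function.onFun, Set.disjoint_left]
    rintro _ ⟨x, hx, rfl⟩ ⟨y, hy, hxy⟩
    have h1 := hcl _ _ (setOf_sameCycle_eq_iff.1 hxy)
    rw [M.component_eq_of_mem hx, M.component_eq_of_mem hy] at h1
    exact hab (Subtype.ext h1.symm)

/-- The Euler characteristics of all components of a planar embedded graph, added up. -/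
theorem IsPlanar.sum_eq [Finite D] {M : RotationSystem D} (h : M.IsPlanar) :
    (numCycles M.rot Set.univ : ℤ) - numCycles M.opp Set.univ
      + numCycles (M.rot * M.opp) Set.univ = 2 * (Set.range M.component).ncard := by
  have := Fintype.ofFinite (Set.range M.component)
  have h1 : ∀ x, M.rot x ∈ M.component x := fun x =>
    M.rot_mem_component.2 (M.mem_component_self x)
  have h2 : ∀ x, M.opp x ∈ M.component x := fun x =>
    M.opp_mem_component.2 (M.mem_component_self x)
  rw [M.numCycles_univ_eq_sum h1, M.numCycles_univ_eq_sum h2,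
    M.numCycles_univ_eq_sum (p := M.rot * M.opp)
      (fun x => by rw [Equiv.Perm.mul_apply, M.rot_mem_component]; exact h2 x),
    finsum_eq_sum_of_fintype, finsum_eq_sum_of_fintype, finsum_eq_sum_of_fintype,
    ← Finset.sum_sub_distrib, ← Finset.sum_add_distrib]
  rw [Finset.sum_congr rfl (g := fun _ => (2 : ℤ))]
  · rw [Finset.sum_const, Finset.card_univ, ← Nat.card_eq_fintype_card, Nat.card_coe_set_eq,
      nsmul_eq_mul, mul_comm]
  · rintro ⟨_, x, rfl⟩ _
    exact h x

end RotationSystem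

/-! ### Euler characteristic of the canonical embedding -/

namespace ColourfulGraph

variable {d n : ℕ}

theorem IsBipartition.white_nbr {G : ColourfulGraph d n} {white : Fin n → Bool}
    (hw : G.IsBipartition white) (c : Fin (d + 1)) (v : Fin n) :
    white (G.nbr c v) = !white v :=
  Bool.eq_not.2 (hw c v)

/-- The permutation that follows the edge of colour `b` and then the edge of colour `a` from every
white vertex, and fixes the black vertices. Its cycles on white vertices are the cycles of `G` with
colours `a` and `b`. -/
def whitePerm (G : ColourfulGraph d n) {white : Fin n → Bool} (hw : G.IsBipartition white)
    (a b : Fin (d + 1)) : Perm (Fin n) where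
  toFun v := if white v then G.nbr a (G.nbr b v) else v
  invFun v := if white v then G.nbr b (G.nbr a v) else v
  left_inv v := by by_cases h : white v <;> simp [h, hw.white_nbr, G.nbr_nbr]
  right_inv v := by by_cases h : white v <;> simp [h, hw.white_nbr, G.nbr_nbr]

section

variable (G : ColourfulGraph d n) {white : Fin n → Bool} (hw : G.IsBipartition white)

theorem whitePerm_of_white (a b : Fin (d + 1)) {v : Fin n} (hv : white v = true) :
    G.whitePerm hw a b v = G.nbr a (G.nbr b v) := by
  simp [whitePerm, hv]

theorem whitePerm_of_black (a b : Fin (d + 1)) {v : Fin n} (hv : white v = false) :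
    G.whitePerm hw a b v = v := by
  simp [whitePerm, hv]

theorem white_whitePerm (a b : Fin (d + 1)) (v : Fin n) :
    white (G.whitePerm hw a b v) = white v := by
  by_cases h : white v <;> simp [whitePerm, h, hw.white_nbr]

theorem whitePerm_self (a : Fin (d + 1)) : G.whitePerm hw a a = 1 := by
  ext v
  simp [whitePerm, G.nbr_nbr]

theorem whitePerm_inv (a b : Fin (d + 1)) : (G.whitePerm hw a b)⁻¹ = G.whitePerm hw b a := rfl

/-- The permutations of the three pairs of colours in a triple are two permutations and their
product, so that a triple of colours is a bipartite map encoded by two permutations. -/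
theorem whitePerm_mul (a b c : Fin (d + 1)) :
    G.whitePerm hw a b * G.whitePerm hw b c = G.whitePerm hw a c := by
  ext v
  by_cases h : white v <;> simp [whitePerm, h, G.nbr_nbr, hw.white_nbr]

end

section Embedding

variable (G : ColourfulGraph 2 n) {white : Fin n → Bool} (hw : G.IsBipartition white)

theorem rot_of_white {v : Fin n} (hv : white v = true) (c : Fin 3) :
    (G.canonicalEmbedding white hw).rot (v, c) = (v, c + 1) := by
  simp [canonicalEmbedding, hv]

theorem rot_of_black {v : Fin n} (hv : white v = false) (c : Fin 3) :
    (G.canonicalEmbedding white hw).rot (v, c) = (v, c - 1) := by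
  simp [canonicalEmbedding, hv]

theorem opp_apply (v : Fin n) (c : Fin 3) :
    (G.canonicalEmbedding white hw).opp (v, c) = (G.nbr c v, c) := rfl

theorem sameCycle_rot (v : Fin n) (c c' : Fin 3) :
    (G.canonicalEmbedding white hw).rot.SameCycle (v, c) (v, c') := by
  have h1 : ∀ c, (G.canonicalEmbedding white hw).rot.SameCycle (v, c) (v, c + 1) := fun c => by
    by_cases hv : white v
    · exact ⟨1, by rw [zpow_one, rot_of_white G hw hv]⟩
    · refine Perm.SameCycle.symm ⟨1, ?_⟩
      rw [zpow_one, rot_of_black G hw (by simpa using hv), add_sub_cancel_right]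
  have h2 : c' = c ∨ c' = c + 1 ∨ c' = c + 1 + 1 := by
    revert c c'
    decide
  rcases h2 with rfl | rfl | rfl
  · exact Perm.SameCycle.refl _ _
  · exact h1 c
  · exact (h1 c).trans (h1 (c + 1))

/-- Every cycle of `opp` contains exactly one half-edge at a white vertex. -/
theorem sameCycle_opp_iff {x y : Fin n × Fin 3} (hx : white x.1 = true) (hy : white y.1 = true) :
    (G.canonicalEmbedding white hw).opp.SameCycle x y ↔ x = y := by
  refine ⟨fun h => ?_, fun h => h ▸ Perm.SameCycle.refl _ _⟩
  have := h.eq_of_invariant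
    (f := fun x : Fin n × Fin 3 => ((if white x.1 then x.1 else G.nbr x.2 x.1), x.2)) fun x => by
      obtain ⟨v, c⟩ := x
      rw [opp_apply]
      by_cases hv : white v <;> simp [hv, hw.white_nbr, G.nbr_nbr]
  simpa [hx, hy] using this

/-- The face permutation moves between white and black vertices, using the colours `c` and `c - 1`
alternately. -/
theorem face_of_white {v : Fin n} (hv : white v = true) (c : Fin 3) :
    ((G.canonicalEmbedding white hw).rot * (G.canonicalEmbedding white hw).opp) (v, c)
      = (G.nbr c v, c - 1) := by
  rw [Perm.mul_apply, opp_apply, rot_of_black]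
  simp [hw.white_nbr, hv]

theorem face_of_black {v : Fin n} (hv : white v = false) (c : Fin 3) :
    ((G.canonicalEmbedding white hw).rot * (G.canonicalEmbedding white hw).opp) (v, c)
      = (G.nbr c v, c + 1) := by
  rw [Perm.mul_apply, opp_apply, rot_of_white]
  simp [hw.white_nbr, hv]

/-- An invariant `f` of the white vertices, such that the step along an edge followed by `β`
preserves `f` on white vertices, extends to an invariant of the components. -/
theorem eq_of_mem_component {ι : Type*} {f : Fin n → ι} {β : Fin n → Fin n}
    (h : ∀ t v, white v = true → f (β (G.nbr t v)) = f v) {x y : Fin n × Fin 3}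
    (hxy : y ∈ (G.canonicalEmbedding white hw).component x) :
    f (if white y.1 then y.1 else β y.1) = f (if white x.1 then x.1 else β x.1) := by
  refine RotationSystem.eq_of_mem_component _
    (f := fun x : Fin n × Fin 3 => f (if white x.1 then x.1 else β x.1)) (fun x => rfl) ?_ hxy
  rintro ⟨v, t⟩
  rw [opp_apply]
  by_cases hv : white v
  · have : white (G.nbr t v) = false := by simp [hw.white_nbr, hv]
    simp only [this, hv, if_true, Bool.false_eq_true, if_false]
    exact h t v hv
  · have hu : white (G.nbr t v) = true := by simpa [hw.white_nbr] using hv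
    simp only [hu, hv, if_true, Bool.false_eq_true, if_false]
    rw [← h t _ hu, G.nbr_nbr]

variable {G hw}

/-- The cycles of `rot` are the vertices. -/
theorem numCycles_rot_eq (S : Set (Fin n)) :
    numCycles (G.canonicalEmbedding white hw).rot {x | x.1 ∈ S} = S.ncard := by
  rw [numCycles_eq_ncard_image (f := Prod.fst)]
  · congr 1
    ext v
    simp
  · rintro ⟨u, c⟩ - ⟨v, c'⟩ -
    constructor
    · rintro rfl
      exact sameCycle_rot G hw _ _ _
    · intro h
      exact h.eq_of_invariant fun x => rfl

/-- Each colour matches the white vertices with the black vertices. -/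
theorem ncard_eq_two_mul {S : Set (Fin n)} (hw : G.IsBipartition white) (c : Fin 3)
    (hS : ∀ v ∈ S, G.nbr c v ∈ S) :
    S.ncard = 2 * (S ∩ {v | white v = true}).ncard := by
  have h1 : S = (S ∩ {v | white v = true}) ∪ (G.nbr c) '' (S ∩ {v | white v = true}) := by
    ext v
    constructor
    · intro hv
      by_cases h : white v
      · exact Or.inl ⟨hv, h⟩
      · exact Or.inr ⟨G.nbr c v, ⟨hS v hv, by simpa [hw.white_nbr] using h⟩, G.nbr_nbr c v⟩
    · rintro (h | ⟨u, hu, rfl⟩)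
      · exact h.1
      · exact hS u hu.1
  have hd : Disjoint (S ∩ {v | white v = true}) ((G.nbr c) '' (S ∩ {v | white v = true})) := by
    rw [Set.disjoint_left]
    rintro _ ⟨-, h⟩ ⟨u, ⟨-, hu⟩, rfl⟩
    simp only [Set.mem_ofPred_eq, hw.white_nbr] at h hu
    simp [hu] at h
  conv_lhs => rw [h1]
  rw [Set.ncard_union_eq hd, Set.ncard_image_of_injective, two_mul]
  exact Function.LeftInverse.injective (g := G.nbr c) (G.nbr_nbr c)

/-- The cycles of `opp` are the edges, three at every white vertex. -/
theorem numCycles_opp_eq {S : Set (Fin n)} (hS : ∀ c, ∀ v ∈ S, G.nbr c v ∈ S) :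
    numCycles (G.canonicalEmbedding white hw).opp {x | x.1 ∈ S}
      = 3 * (S ∩ {v | white v = true}).ncard := by
  set M := G.canonicalEmbedding white hw with hM
  let f : Fin n × Fin 3 → Fin n × Fin 3 := fun x =>
    ((if white x.1 then x.1 else G.nbr x.2 x.1), x.2)
  have hfw : ∀ x, white (f x).1 = true := by
    rintro ⟨v, c⟩
    by_cases hv : white v <;> simp [f, hv, hw.white_nbr]
  have hfs : ∀ x, M.opp.SameCycle x (f x) := by
    rintro ⟨v, c⟩
    by_cases hv : white v
    · simpa [f, hv] using Perm.SameCycle.refl _ _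
    · exact ⟨1, by simp [f, hv, hM, opp_apply]⟩
  rw [numCycles_eq_ncard_image (f := f)]
  · have : f '' {x | x.1 ∈ S} = (S ∩ {v | white v = true}) ×ˢ (Set.univ : Set (Fin 3)) := by
      ext ⟨v, c⟩
      constructor
      · rintro ⟨⟨u, c'⟩, hu, h⟩
        have h2 := hfw (u, c')
        rw [h] at h2
        refine ⟨⟨?_, h2⟩, trivial⟩
        rw [← h]
        by_cases hu' : white u
        · simpa [f, hu'] using hu
        · simpa [f, hu'] using hS c' u hu
      · rintro ⟨⟨hv, hvw⟩, -⟩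
        exact ⟨(v, c), hv, by simp only [f, Set.mem_ofPred_eq] at hvw ⊢; simp [hvw]⟩
    rw [this, Set.ncard_prod, Set.ncard_univ]
    simp [mul_comm]
  · intro x _ y _
    rw [← sameCycle_opp_iff G hw (hfw x) (hfw y)]
    exact ⟨fun h => ((hfs x).trans h).trans (hfs y).symm,
      fun h => ((hfs x).symm.trans h).trans (hfs y)⟩

/-- The faces of the canonical embedding are the bicoloured cycles. -/
theorem numCycles_face_eq {S : Set (Fin n)} (hS : ∀ c, ∀ v ∈ S, G.nbr c v ∈ S) :
    numCycles ((G.canonicalEmbedding white hw).rot * (G.canonicalEmbedding white hw).opp)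
      {x | x.1 ∈ S}
      = ∑ c : Fin 3, numCycles (G.whitePerm hw (c - 1) c) (S ∩ {v | white v = true}) := by
  set F := (G.canonicalEmbedding white hw).rot * (G.canonicalEmbedding white hw).opp with hF
  let cl : Fin 3 → Fin n → Set (Fin n) := fun c v => {u | (G.whitePerm hw (c - 1) c).SameCycle v u}
  -- the half-edge at a white vertex that represents the half-edge `x` in its face
  let g : Fin n × Fin 3 → Fin n × Fin 3 := fun x =>
    if white x.1 then x else (G.nbr x.2 x.1, x.2 + 1)
  have hgw : ∀ x, white (g x).1 = true := by
    rintro ⟨v, c⟩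
    by_cases hv : white v <;> simp [g, hv, hw.white_nbr]
  have hgs : ∀ x, F.SameCycle x (g x) := by
    rintro ⟨v, c⟩
    by_cases hv : white v
    · simpa [g, hv] using Perm.SameCycle.refl _ _
    · refine ⟨1, ?_⟩
      rw [zpow_one, hF, face_of_black G hw (by simpa using hv)]
      simp [g, hv]
  have hF2 : ∀ v c, white v = true → F (F (v, c)) = (G.whitePerm hw (c - 1) c v, c) := by
    intro v c hv
    rw [hF, face_of_white G hw hv, face_of_black G hw (by simp [hw.white_nbr, hv]),
      whitePerm_of_white G hw _ _ hv, sub_add_cancel]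
  let f : Fin n × Fin 3 → Fin 3 × Set (Fin n) := fun x => ((g x).2, cl (g x).2 (g x).1)
  have hfinv : ∀ x, f (F x) = f x := by
    rintro ⟨v, c⟩
    by_cases hv : white v
    · rw [hF, face_of_white G hw hv]
      have : white (G.nbr c v) = false := by simp [hw.white_nbr, hv]
      simp only [f, g, this, hv, if_true, Bool.false_eq_true, if_false, sub_add_cancel]
      rw [Prod.mk.injEq]
      refine ⟨rfl, setOf_sameCycle_eq_iff.2 ?_⟩
      rw [← whitePerm_of_white G hw _ _ hv]
      exact Perm.sameCycle_apply_left.2 (Perm.SameCycle.refl _ _)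
    · have hv' : white v = false := by simpa using hv
      have : white (G.nbr c v) = true := by simp [hw.white_nbr, hv']
      rw [hF, face_of_black G hw hv']
      simp only [f, g, this, hv, if_true, Bool.false_eq_true, if_false]
  have hwhite : ∀ c u v, white u = true → (G.whitePerm hw (c - 1) c).SameCycle u v →
      F.SameCycle (u, c) (v, c) := by
    intro c u v hu h
    have := h.eq_of_invariant
      (f := fun u => if white u then {z | F.SameCycle (u, c) z} else ∅) fun u => by
        by_cases hu : white u
        · simp only [white_whitePerm, hu, if_true]
          refine setOf_sameCycle_eq_iff.2 ?_
          rw [← hF2 u c hu, Perm.sameCycle_apply_left, Perm.sameCycle_apply_left]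
        · rw [whitePerm_of_black G hw _ _ (by simpa using hu)]
    have hv : white v = true := by
      rw [← hu]
      exact (h.eq_of_invariant (f := white) fun u => white_whitePerm G hw _ _ u).symm
    simp only [hu, hv, if_true] at this
    exact setOf_sameCycle_eq_iff.1 this
  rw [numCycles_eq_ncard_image (f := f)]
  · have himg : f '' {x | x.1 ∈ S} = ⋃ c : Fin 3,
        (Prod.mk c) '' (cl c '' (S ∩ {v | white v = true})) := by
      ext y
      simp only [Set.mem_iUnion]
      constructor
      · rintro ⟨x, hx, rfl⟩
        refine ⟨(g x).2, _, ⟨(g x).1, ⟨?_, hgw x⟩, rfl⟩, rfl⟩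
        by_cases hx' : white x.1
        · simpa [g, hx'] using hx
        · simpa [g, hx'] using hS x.2 x.1 hx
      · rintro ⟨c, _, ⟨v, ⟨hv, hvw⟩, rfl⟩, rfl⟩
        refine ⟨(v, c), hv, ?_⟩
        simp only [Set.mem_ofPred_eq] at hvw
        simp [f, g, hvw]
    rw [himg, Set.ncard_iUnion_of_finite (fun _ => Set.toFinite _), finsum_eq_sum_of_fintype]
    · refine Finset.sum_congr rfl fun c _ => ?_
      rw [Set.ncard_image_of_injective _ (Prod.mk_right_injective c)]
      rfl
    · intro c c' hcc
      rw [Function.onFun, Set.disjoint_left]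
      rintro _ ⟨_, _, rfl⟩ ⟨_, _, h⟩
      exact hcc (congrArg Prod.fst h).symm
  · intro x _ y _
    constructor
    · intro h
      simp only [f, Prod.mk.injEq] at h
      obtain ⟨h1, h2⟩ := h
      rw [h1] at h2
      have h3 := hwhite _ _ _ (hgw x) (setOf_sameCycle_eq_iff.1 h2)
      have hx : g x = ((g x).1, (g y).2) := by rw [← h1]
      have : F.SameCycle (g x) (g y) := by rw [hx]; exact h3
      exact ((hgs x).trans this).trans (hgs y).symm
    · intro h
      exact h.eq_of_invariant hfinv

/-- The Euler characteristic of a component: `F` minus the number of white vertices. -/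
theorem eulerChar_eq {S : Set (Fin n)} (hS : ∀ c, ∀ v ∈ S, G.nbr c v ∈ S) {x : Fin n × Fin 3}
    (hx : (G.canonicalEmbedding white hw).component x = {y | y.1 ∈ S}) :
    (G.canonicalEmbedding white hw).eulerChar x
      = ∑ c : Fin 3, (numCycles (G.whitePerm hw (c - 1) c) (S ∩ {v | white v = true}) : ℤ)
        - (S ∩ {v | white v = true}).ncard := by
  rw [eulerChar, hx, numCycles_rot_eq, numCycles_opp_eq hS, numCycles_face_eq hS,
    ncard_eq_two_mul hw 0 (hS 0)]
  push_cast
  ring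

end Embedding

end ColourfulGraph

/-! ### The constraint imposed by a planar triple of colours -/

/-- A symmetric function summed over the three pairs of elements of `{a, b, c}`, in whatever order
`e` enumerates that set. -/
theorem sum_cyclic_eq {ι : Type*} {f : ι → ι → ℕ} (hf : ∀ a b, f a b = f b a) {e : Fin 3 → ι}
    {a b c : ι} (hab : a ≠ b) (hac : a ≠ c) (hbc : b ≠ c)
    (ha : a ∈ Set.range e) (hb : b ∈ Set.range e) (hc : c ∈ Set.range e) :
    ∑ t : Fin 3, f (e (t - 1)) (e t) = f a b + f b c + f a c := by
  obtain ⟨i, rfl⟩ := ha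
  obtain ⟨j, rfl⟩ := hb
  obtain ⟨k, rfl⟩ := hc
  have h01 := hf (e 0) (e 1)
  have h02 := hf (e 0) (e 2)
  have h12 := hf (e 1) (e 2)
  have hij : i ≠ j := fun h => hab (by rw [h])
  have hik : i ≠ k := fun h => hac (by rw [h])
  have hjk : j ≠ k := fun h => hbc (by rw [h])
  rw [Fin.sum_univ_three, show (0 : Fin 3) - 1 = 2 by decide, show (1 : Fin 3) - 1 = 0 by decide,
    show (2 : Fin 3) - 1 = 1 by decide]
  fin_cases i <;> fin_cases j <;> fin_cases k <;> simp at hij hik hjk ⊢ <;> omega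

namespace ColourfulGraph

variable {d n : ℕ} {G : ColourfulGraph d n} {white : Fin n → Bool}

/-- All `3`-coloured subgraphs are planar, for a given bipartition. -/
def PlanarWith (G : ColourfulGraph d n) {white : Fin n → Bool} (hw : G.IsBipartition white) :
    Prop :=
  ∀ (I : Finset (Fin (d + 1))) (hI : I.card = 2 + 1),
    ((G.restrict I hI).canonicalEmbedding white fun _ v => hw _ v).IsPlanar

/-- Every black vertex is a fixed point, which has to be discounted. -/
theorem cycleCount_whitePerm (hw : G.IsBipartition white) (a b : Fin (d + 1)) :
    cycleCount (G.whitePerm hw a b)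
      = numCycles (G.whitePerm hw a b) {v | white v = true} + {v | white v = false}.ncard := by
  have hU : (Set.univ : Set (Fin n)) = {v | white v = true} ∪ {v | white v = false} := by
    ext v
    simp
  have hb : numCycles (G.whitePerm hw a b) {v | white v = false}
      = {v | white v = false}.ncard := by
    rw [numCycles_eq_ncard_image (f := id), Set.image_id]
    intro x hx y _
    exact ⟨fun h => (show x = y from h) ▸ Perm.SameCycle.refl _ _,
      fun h => h.eq_of_left (whitePerm_of_black G hw a b hx)⟩
  rw [← hb, cycleCount, numCycles, hU, Set.image_union, Set.ncard_union_eq]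
  · rfl
  rw [Set.disjoint_left]
  rintro _ ⟨x, hx, rfl⟩ ⟨y, hy, hxy⟩
  have := (setOf_sameCycle_eq_iff.1 hxy).eq_of_invariant (f := white) fun u =>
    white_whitePerm G hw a b u
  rw [Set.mem_ofPred_eq] at hx hy
  rw [hx, hy] at this
  exact absurd this (by simp)

theorem ncard_white_add_ncard_black (white : Fin n → Bool) :
    {v | white v = true}.ncard + {v | white v = false}.ncard = n := by
  rw [← Set.ncard_union_eq]
  · have : {v | white v = true} ∪ {v | white v = false} = Set.univ := by
      ext v
      simp
    rw [this, Set.ncard_univ, Nat.card_eq_fintype_card, Fintype.card_fin]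
  · rw [Set.disjoint_left]
    intro v hv hv'
    rw [Set.mem_ofPred_eq] at hv hv'
    exact absurd (hv.symm.trans hv') (by simp)

theorem IsBipartition.two_mul_ncard_white (hw : G.IsBipartition white) :
    2 * {v | white v = true}.ncard = n := by
  have hblack : {v | white v = false} = G.nbr 0 '' {v | white v = true} := by
    ext v
    constructor
    · intro hv
      rw [Set.mem_ofPred_eq] at hv
      exact ⟨G.nbr 0 v, by simp [hw.white_nbr, hv], G.nbr_nbr 0 v⟩
    · rintro ⟨u, hu, rfl⟩
      rw [Set.mem_ofPred_eq] at hu ⊢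
      simp [hw.white_nbr, hu]
  have h := ncard_white_add_ncard_black white
  rw [hblack, Set.ncard_image_of_injective _
    (Function.LeftInverse.injective (g := G.nbr 0) (G.nbr_nbr 0))] at h
  omega

/-- The planarity of the triple of colours `a, b, c`, as a condition on the permutations of the
white vertices: `k` is the number of components (plus the number of black vertices, which are
fixed by all permutations in play). -/
theorem PlanarWith.exists_card_components {hw : G.IsBipartition white} (h : G.PlanarWith hw)
    {a b c : Fin (d + 1)} (hab : a ≠ b) (hac : a ≠ c) (hbc : b ≠ c) :
    ∃ k, cycleCount (G.whitePerm hw a b) + cycleCount (G.whitePerm hw b c)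
        + cycleCount (G.whitePerm hw a c) = n + 2 * k ∧
      {v | white v = false}.ncard ≤ k ∧
      ∀ z : Perm (Fin n), (∀ i, z.SameCycle i (G.whitePerm hw a b i)) →
        (∀ i, z.SameCycle i (G.whitePerm hw b c i)) → cycleCount z ≤ k := by
  set I : Finset (Fin (d + 1)) := {a, b, c} with hIdef
  have hI : I.card = 2 + 1 := Finset.card_eq_three.2 ⟨a, b, c, hab, hac, hbc, rfl⟩
  let e : Fin 3 → Fin (d + 1) := I.orderEmbOfFin hI
  have he : Set.range e = I := I.range_orderEmbOfFin hI
  have hwI : (G.restrict I hI).IsBipartition white := fun _ v => hw _ v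
  set M := (G.restrict I hI).canonicalEmbedding white hwI with hM
  have hsum := (show M.IsPlanar from h I hI).sum_eq
  have hclosed : ∀ c, ∀ v ∈ (Set.univ : Set (Fin n)), (G.restrict I hI).nbr c v ∈ Set.univ :=
    fun _ _ _ => Set.mem_univ _
  have hU : (Set.univ : Set (Fin n × Fin 3)) = {x | x.1 ∈ (Set.univ : Set (Fin n))} := by
    ext
    simp
  have hw2 := hw.two_mul_ncard_white
  have hbw := ncard_white_add_ncard_black white
  set W := {v | white v = true} with hW
  set B := {v | white v = false} with hB
  have hrot : numCycles M.rot Set.univ = n := by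
    rw [hU, hM, numCycles_rot_eq, Set.ncard_univ, Nat.card_eq_fintype_card, Fintype.card_fin]
  have hopp : numCycles M.opp Set.univ = 3 * W.ncard := by
    rw [hU, hM, numCycles_opp_eq hclosed, Set.univ_inter]
  have hface : numCycles (M.rot * M.opp) Set.univ
      = ∑ t : Fin 3, numCycles (G.whitePerm hw (e (t - 1)) (e t)) W := by
    rw [hU, hM, numCycles_face_eq hclosed, Set.univ_inter]
    rfl
  have hfaces : ∑ t : Fin 3, cycleCount (G.whitePerm hw (e (t - 1)) (e t))
      = ∑ t : Fin 3, numCycles (G.whitePerm hw (e (t - 1)) (e t)) W + 3 * B.ncard := by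
    rw [Finset.sum_congr rfl fun t _ => cycleCount_whitePerm hw (e (t - 1)) (e t),
      Finset.sum_add_distrib]
    simp [hW, hB]
  have hmem : ∀ x ∈ I, x ∈ Set.range e := fun x hx => he ▸ hx
  rw [sum_cyclic_eq (f := fun a b => cycleCount (G.whitePerm hw a b))
    (fun a b => by rw [← cycleCount_inv, whitePerm_inv]) hab hac hbc
    (hmem a (by simp [hIdef])) (hmem b (by simp [hIdef])) (hmem c (by simp [hIdef]))] at hfaces
  rw [hrot, hopp, hface] at hsum
  refine ⟨(Set.range M.component).ncard + B.ncard, by omega, by omega, fun z hza hzc => ?_⟩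
  let cl : Fin n → Set (Fin n) := fun v => {u | z.SameCycle v u}
  -- an invariant of the components, whose values exhaust the classes of the white vertices
  let f : Fin n × Fin 3 → Set (Fin n) := fun x =>
    cl (if white x.1 then x.1 else G.nbr b x.1)
  have hz : ∀ t v, white v = true → cl (G.nbr b (G.nbr (e t) v)) = cl v := by
    intro t v hv
    rw [← whitePerm_of_white G hw b _ hv]
    refine setOf_sameCycle_eq_iff.2 (Perm.SameCycle.symm ?_)
    have ht : e t ∈ I := by
      rw [← Finset.mem_coe, ← he]
      exact ⟨t, rfl⟩
    rw [hIdef, Finset.mem_insert, Finset.mem_insert, Finset.mem_singleton] at ht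
    rcases ht with ht | ht | ht
    · have := hza (G.whitePerm hw b a v)
      rw [← Perm.mul_apply, whitePerm_mul, whitePerm_self] at this
      rw [ht]
      exact this.symm
    · rw [ht, whitePerm_self]
      exact Perm.SameCycle.refl _ _
    · rw [ht]
      exact hzc v
  have hrange : Set.range f = (fun K : Set (Fin n × Fin 3) => ⋃ y ∈ K, f y) ''
      Set.range M.component := by
    rw [← Set.range_comp]
    congr 1
    ext x v
    simp only [Function.comp_apply, Set.mem_iUnion]
    exact ⟨fun hv => ⟨x, M.mem_component_self x, hv⟩, fun ⟨y, hy, hv⟩ => by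
      rwa [show f y = f x from eq_of_mem_component _ hwI (f := cl) (β := G.nbr b)
        (fun t v hv => hz t v hv) hy] at hv⟩
  have hsub : Set.range cl ⊆ Set.range f ∪ cl '' B := by
    rintro _ ⟨v, rfl⟩
    by_cases hv : white v
    · exact Or.inl ⟨(v, 0), by simp [f, hv]⟩
    · exact Or.inr ⟨v, by simpa [hB] using hv, rfl⟩
  rw [cycleCount_eq_ncard_range fun x y => setOf_sameCycle_eq_iff]
  refine (Set.ncard_le_ncard hsub (Set.toFinite _)).trans ((Set.ncard_union_le _ _).trans ?_)
  refine add_le_add ?_ (Set.ncard_image_le (Set.toFinite _))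
  rw [hrange]
  exact Set.ncard_image_le (Set.toFinite _)

/-- The Cayley length of `whitePerm`: half the number of vertices minus the number of cycles of
`G` with colours `a` and `b`. -/
noncomputable def whiteLength (G : ColourfulGraph d n) {white : Fin n → Bool}
    (hw : G.IsBipartition white) (a b : Fin (d + 1)) : ℕ :=
  n - cycleCount (G.whitePerm hw a b)

theorem cycleCount_add_whiteLength (hw : G.IsBipartition white) (a b : Fin (d + 1)) :
    cycleCount (G.whitePerm hw a b) + whiteLength G hw a b = n := by
  have := cycleCount_le_card (G.whitePerm hw a b)
  rw [Fintype.card_fin] at this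
  rw [whiteLength]
  omega

theorem whiteLength_comm (hw : G.IsBipartition white) (a b : Fin (d + 1)) :
    whiteLength G hw a b = whiteLength G hw b a := by
  rw [whiteLength, whiteLength, ← cycleCount_inv, whitePerm_inv]

theorem whiteLength_self (hw : G.IsBipartition white) (a : Fin (d + 1)) :
    whiteLength G hw a a = 0 := by
  rw [whiteLength, whitePerm_self, cycleCount_one, Fintype.card_fin, Nat.sub_self]

/-- The genus `0` relation without the contribution of the components. -/
theorem PlanarWith.whiteLength_add_le {hw : G.IsBipartition white} (h : G.PlanarWith hw)
    {a b c : Fin (d + 1)} (hab : a ≠ b) (hac : a ≠ c) (hbc : b ≠ c) :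
    whiteLength G hw a b + whiteLength G hw b c + whiteLength G hw a c ≤ n := by
  obtain ⟨k, hk, hk', -⟩ := h.exists_card_components hab hac hbc
  have h1 := cycleCount_add_whiteLength hw a b
  have h2 := cycleCount_add_whiteLength hw b c
  have h3 := cycleCount_add_whiteLength hw a c
  have h4 := hw.two_mul_ncard_white
  have h5 := ncard_white_add_ncard_black white
  omega

/-- The colour `c` is determined by one of few permutations once the colours `a` and `b` are
known. The number `r` is the number of cycles with colours `a, b` minus the number of components
with colours `a, b, c`. -/
theorem PlanarWith.exists_mem_planarPartners {hw : G.IsBipartition white} (h : G.PlanarWith hw)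
    {a b : Fin (d + 1)} (hab : a ≠ b) (c : Fin (d + 1)) :
    ∃ r : Fin (n + 1),
      2 * (r : ℕ) + whiteLength G hw a b = whiteLength G hw b c + whiteLength G hw a c ∧
      G.whitePerm hw b c ∈ planarPartners (G.whitePerm hw a b) r := by
  have hl := cycleCount_add_whiteLength hw a b
  by_cases hac : a = c
  · subst hac
    refine ⟨0, by rw [whiteLength_self, whiteLength_comm]; simp, mem_planarPartners_zero ?_⟩
    rw [mem_geodesicSet, whitePerm_mul, whitePerm_self, cycleCount_one, ← cycleCount_inv,
      whitePerm_inv, add_comm]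
  by_cases hbc : b = c
  · subst hbc
    refine ⟨0, by rw [whiteLength_self]; simp, mem_planarPartners_zero ?_⟩
    rw [mem_geodesicSet, whitePerm_mul, whitePerm_self, cycleCount_one]
  obtain ⟨k, hk, hk', horb⟩ := h.exists_card_components hab hac hbc
  have hl2 := cycleCount_add_whiteLength hw b c
  have hl3 := cycleCount_add_whiteLength hw a c
  have htri : k ≤ cycleCount (G.whitePerm hw a b) := by
    have h1 := cycleCount_add_le (G.whitePerm hw a c) (G.whitePerm hw c b)
    have h2 : cycleCount (G.whitePerm hw c b) = cycleCount (G.whitePerm hw b c) := by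
      rw [← cycleCount_inv, whitePerm_inv]
    rw [whitePerm_mul, h2, Fintype.card_fin] at h1
    omega
  refine ⟨⟨cycleCount (G.whitePerm hw a b) - k, by omega⟩, by simp only; omega,
    mem_planarPartners (k := k) ?_ horb (by simp only; omega)⟩
  rw [whitePerm_mul, Fintype.card_fin, hk]

/-- The graph is determined by one colour and the permutations that relate it to the others. -/
theorem ext_of_whitePerm {G G' : ColourfulGraph d n} {hw : G.IsBipartition white}
    {hw' : G'.IsBipartition white} (b : Fin (d + 1))
    (hb : ∀ v, white v = true → G.nbr b v = G'.nbr b v)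
    (hc : ∀ c, G.whitePerm hw b c = G'.whitePerm hw' b c) : G = G' := by
  have hwh : ∀ c v, white v = true → G.nbr c v = G'.nbr c v := by
    intro c v hv
    have h1 := whitePerm_of_white G hw b c hv
    have h2 := whitePerm_of_white G' hw' b c hv
    rw [hc] at h1
    have h3 := hb _ ((white_whitePerm G' hw' b c v).trans hv)
    rw [h1, G.nbr_nbr, h1.symm.trans h2, G'.nbr_nbr] at h3
    exact h3
  ext c v : 3
  by_cases hv : white v
  · rw [hwh c v hv]
  · have hu : white (G.nbr c v) = true := by simpa [hw.white_nbr] using hv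
    have h1 := hwh c _ hu
    rw [G.nbr_nbr] at h1
    conv_rhs => rw [h1, G'.nbr_nbr]

end ColourfulGraph

/-! ### The upper bound -/

/-- Averaging over all ordered pairs of distinct colours `(a, b)`. With `f` the length function of a
graph, six times the exponent of the length class obtained from `a` and `b` is
`3 * (n + 2 * f a b + ∑ c, (f b c + f a c - f a b))`. -/
theorem exists_pair_of_triples_le {d n : ℕ} (hd : 2 ≤ d) {f : Fin (d + 1) → Fin (d + 1) → ℕ}
    (hsymm : ∀ a b, f a b = f b a) (hself : ∀ a, f a a = 0)
    (htri : ∀ a b c, a ≠ b → a ≠ c → b ≠ c → f a b + f b c + f a c ≤ n) :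
    ∃ a b, a ≠ b ∧
      3 * (n + 2 * f a b + ∑ c, (f b c + f a c)) ≤ (d + 4) * n + 3 * (d + 1) * f a b := by
  set T : ℤ := ∑ a, ∑ b, (f a b : ℤ) with hT
  -- the total over all triples, corrected for the triples with repeated colours
  have h1 : ∀ a b c, (f a b + f b c + f a c : ℤ) ≤ n
      - (if a = b then (n : ℤ) else 0) - (if b = c then (n : ℤ) else 0)
      - (if a = c then (n : ℤ) else 0) + 2 * (if a = b then if a = c then (n : ℤ) else 0 else 0)
      + 2 * (if a = b then (f a c : ℤ) else 0) + 2 * (if b = c then (f a b : ℤ) else 0)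
      + 2 * (if a = c then (f a b : ℤ) else 0) := by
    intro a b c
    by_cases hab : a = b
    · subst hab
      by_cases hac : a = c
      · subst hac
        simp only [hself, if_true]
        push_cast
        linarith
      · simp only [hself, if_true, hac, if_false]
        push_cast
        linarith
    · by_cases hac : a = c
      · subst hac
        have hba : ¬ b = a := fun h => hab h.symm
        simp only [hself, if_true, hab, hba, if_false, hsymm b a]
        push_cast
        linarith
      · by_cases hbc : b = c
        · subst hbc
          simp only [hself, if_true, hab, if_false]
          push_cast
          linarith
        · simp only [hab, hac, hbc, if_false]
          have := htri a b c hab hac hbc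
          push_cast
          zify at this
          linarith
  have h2 := Finset.sum_le_sum fun a (_ : a ∈ Finset.univ) =>
    Finset.sum_le_sum fun b (_ : b ∈ Finset.univ) =>
      Finset.sum_le_sum fun c (_ : c ∈ Finset.univ) => h1 a b c
  simp only [Finset.sum_add_distrib, Finset.sum_sub_distrib, ← Finset.mul_sum,
    Finset.sum_ite_eq, Finset.sum_ite_irrel, Finset.mem_univ, if_true, Finset.sum_const,
    Finset.card_univ, Fintype.card_fin, nsmul_eq_mul, mul_zero] at h2
  rw [← hT] at h2
  have h3 : 3 * T ≤ (d + 1) * d * n := by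
    have hd' : (0 : ℤ) < d - 1 := by
      have : (2 : ℤ) ≤ d := by exact_mod_cast hd
      linarith
    have : (d - 1 : ℤ) * (3 * T) ≤ (d - 1) * ((d + 1) * d * n) := by
      push_cast at h2
      linarith
    exact le_of_mul_le_mul_left this hd'
  by_contra hcon
  push Not at hcon
  let F : Fin (d + 1) → Fin (d + 1) → ℤ := fun a b =>
    3 * (n + 2 * f a b + ∑ c, (f b c + f a c : ℤ)) - ((d + 4) * n + 3 * (d + 1) * f a b)
  have h4 : ∀ a b, (1 : ℤ) - (if a = b then 1 else 0) ≤ F a b - (if a = b then F a a else 0) := by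
    intro a b
    by_cases hab : a = b
    · subst hab
      simp
    · have := hcon a b hab
      zify at this
      simp only [hab, if_false, F]
      linarith
  have h5 := Finset.sum_le_sum fun a (_ : a ∈ Finset.univ) =>
    Finset.sum_le_sum fun b (_ : b ∈ Finset.univ) => h4 a b
  simp only [F, hself, Finset.sum_add_distrib, Finset.sum_sub_distrib, ← Finset.mul_sum,
    Finset.sum_ite_eq, Finset.mem_univ, if_true, Finset.sum_const,
    Finset.card_univ, Fintype.card_fin, nsmul_eq_mul] at h5
  rw [← hT] at h5
  have hd' : (2 : ℤ) ≤ d := by exact_mod_cast hd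
  push_cast at h5
  nlinarith

namespace ColourfulGraph

variable {d n : ℕ}

/-- The graphs with bipartition `white` for which the permutation of the colours `a` and `b` has
length `r₀` and the permutation that gives the colour `c` is a planar partner of it at distance
`r c`. -/
def lengthClass (white : Fin n → Bool) (a b : Fin (d + 1)) (r₀ : ℕ) (r : Fin (d + 1) → ℕ) :
    Set (ColourfulGraph d n) :=
  {G | ∃ hw : G.IsBipartition white, G.whiteLength hw a b = r₀ ∧
    ∀ c, G.whitePerm hw b c ∈ planarPartners (G.whitePerm hw a b) (r c)}

/-- A graph in the class is determined by the colour `b` on the white vertices, by the permutation of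
`a` and `b`, and by the planar partners of this permutation that give the other colours. -/
theorem ncard_lengthClass_le [NeZero n] (white : Fin n → Bool) (a b : Fin (d + 1)) (r₀ : ℕ)
    (r : Fin (d + 1) → ℕ) :
    (lengthClass white a b r₀ r).ncard ≤
      2 ^ n * (8 ^ n) ^ (d + 1) * n ^ ({v | white v = true}.ncard + r₀ + ∑ c, r c) := by
  classical
  let A : Finset (Fin n → Fin n) :=
    Fintype.piFinset fun v => if white v then Finset.univ else {v}
  let X : Finset (Perm (Fin n)) :=
    Finset.univ.filter fun ρ => Fintype.card (Fin n) ≤ cycleCount ρ + r₀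
  let Y : Perm (Fin n) → Finset (Fin (d + 1) → Perm (Fin n)) := fun x =>
    Fintype.piFinset fun c => planarPartners x (r c)
  let T : Finset ((Fin n → Fin n) × (_ : Perm (Fin n)) × (Fin (d + 1) → Perm (Fin n))) :=
    A ×ˢ X.sigma Y
  let f : ColourfulGraph d n →
      (Fin n → Fin n) × (_ : Perm (Fin n)) × (Fin (d + 1) → Perm (Fin n)) := fun G =>
    if hw : G.IsBipartition white then
      (fun v => if white v then G.nbr b v else v, ⟨G.whitePerm hw a b, fun c => G.whitePerm hw b c⟩)
    else (id, ⟨1, 1⟩)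
  have hf : ∀ G (hw : G.IsBipartition white), f G =
      (fun v => if white v then G.nbr b v else v,
        ⟨G.whitePerm hw a b, fun c => G.whitePerm hw b c⟩) := fun G hw => dif_pos hw
  have hmaps : ∀ G ∈ lengthClass white a b r₀ r, f G ∈ (T : Set _) := by
    rintro G ⟨hw, h₀, h⟩
    rw [hf G hw, Finset.mem_coe, Finset.mem_product, Finset.mem_sigma]
    refine ⟨?_, ?_, ?_⟩
    · rw [Fintype.mem_piFinset]
      intro v
      by_cases hv : white v <;> simp [hv]
    · have := cycleCount_add_whiteLength hw a b
      simp only [X, Finset.mem_filter, Finset.mem_univ, true_and, Fintype.card_fin]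
      omega
    · rw [Fintype.mem_piFinset]
      exact h
  have hinj : Set.InjOn f (lengthClass white a b r₀ r) := by
    rintro G ⟨hw, -⟩ G' ⟨hw', -⟩ h
    rw [hf G hw, hf G' hw'] at h
    simp only [Prod.mk.injEq, Sigma.mk.injEq, heq_eq_eq] at h
    obtain ⟨h1, -, h2⟩ := h
    refine ext_of_whitePerm (hw := hw) (hw' := hw') b (fun v hv => ?_) fun c => congrFun h2 c
    simpa [hv] using congrFun h1 v
  have hA : A.card = n ^ {v | white v = true}.ncard := by
    rw [Fintype.card_piFinset, Set.ncard_eq_toFinset_card', Set.toFinset_ofPred]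
    rw [Finset.prod_congr rfl (g := fun v => if white v = true then n else 1)]
    · rw [Finset.prod_ite, Finset.prod_const, Finset.prod_const_one, mul_one]
    · intro v _
      by_cases hv : white v <;> simp [hv]
  have hX : X.card ≤ 2 ^ n * n ^ r₀ :=
    (card_filter_cycleCount_le (α := Fin n) r₀).trans_eq (by rw [Fintype.card_fin])
  have hY : ∀ x, (Y x).card ≤ (8 ^ n) ^ (d + 1) * n ^ ∑ c, r c := by
    intro x
    rw [Fintype.card_piFinset]
    refine (Finset.prod_le_prod' fun c _ => card_planarPartners_le x (r c)).trans_eq ?_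
    rw [Finset.prod_mul_distrib, Finset.prod_const, Finset.prod_pow_eq_pow_sum]
    simp
  have hT : T.card = A.card * ∑ x ∈ X, (Y x).card := by
    rw [Finset.card_product, Finset.card_sigma]
  have h1 := Set.ncard_le_ncard_of_injOn f hmaps hinj (Finset.finite_toSet T)
  rw [Set.ncard_coe_finset, hT, hA] at h1
  refine h1.trans ?_
  calc n ^ {v | white v = true}.ncard * ∑ x ∈ X, (Y x).card
      ≤ n ^ {v | white v = true}.ncard *
        ((2 ^ n * n ^ r₀) * ((8 ^ n) ^ (d + 1) * n ^ ∑ c, r c)) := by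
        gcongr
        refine (Finset.sum_le_card_nsmul _ _ _ fun x _ => hY x).trans ?_
        rw [smul_eq_mul]
        gcongr
    _ = _ := by
        rw [pow_add, pow_add]
        ring

/-- Every graph lies in a length class whose exponent is at most the average one. -/
theorem IsThreePlanar.exists_mem_lengthClass (hd : 2 ≤ d) {G : ColourfulGraph d n}
    (h : G.IsThreePlanar) :
    ∃ (white : Fin n → Bool) (a b : Fin (d + 1)) (r₀ : Fin (n + 1))
      (r : Fin (d + 1) → Fin (n + 1)),
      6 * ({v | white v = true}.ncard + r₀ + ∑ c, (r c : ℕ)) ≤ (d + 4) * n ∧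
      G ∈ lengthClass white a b r₀ fun c => r c := by
  obtain ⟨white, hw, hG⟩ := h
  replace hG : G.PlanarWith hw := hG
  obtain ⟨a, b, hab, hle⟩ := exists_pair_of_triples_le hd (f := G.whiteLength hw)
    (whiteLength_comm hw) (whiteLength_self hw) fun a b c => hG.whiteLength_add_le
  choose r hr hmem using hG.exists_mem_planarPartners hab
  have hl := cycleCount_add_whiteLength hw a b
  refine ⟨white, a, b, ⟨G.whiteLength hw a b, by omega⟩, r, ?_, hw, rfl, hmem⟩
  have hsum := Finset.sum_congr rfl fun c (_ : c ∈ Finset.univ) => hr c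
  rw [Finset.sum_add_distrib, ← Finset.mul_sum, Finset.sum_const, Finset.card_univ,
    Fintype.card_fin, smul_eq_mul] at hsum
  have hw2 := hw.two_mul_ncard_white
  simp only
  rw [← hsum] at hle
  nlinarith

end ColourfulGraph

open ColourfulGraph in
/-- The number of length classes is only exponential in `n`, so that the largest of them decides. -/
theorem numThreePlanar_le {d n : ℕ} (hd : 2 ≤ d) [NeZero n] :
    (numThreePlanar d n : ℝ) ≤ (d + 1) ^ 2 * (4 * 8 ^ (d + 1) * 2 ^ (d + 2)) ^ n
      * (n : ℝ) ^ (((d : ℝ) + 4) * n / 6) := by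
  classical
  let ι := (Fin n → Bool) × Fin (d + 1) × Fin (d + 1) × Fin (n + 1) × (Fin (d + 1) → Fin (n + 1))
  let P : ι → Prop := fun i => 6 * ({v | i.1 v = true}.ncard + i.2.2.2.1
    + ∑ c, (i.2.2.2.2 c : ℕ)) ≤ (d + 4) * n
  have hsub : {G : ColourfulGraph d n | G.IsThreePlanar} ⊆ ⋃ i ∈ Finset.univ.filter P,
      lengthClass i.1 i.2.1 i.2.2.1 i.2.2.2.1 fun c => i.2.2.2.2 c := by
    intro G hG
    obtain ⟨white, a, b, r₀, r, hle, hmem⟩ := IsThreePlanar.exists_mem_lengthClass hd hG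
    simp only [Set.mem_iUnion]
    exact ⟨(white, a, b, r₀, r), by simpa [P] using hle, hmem⟩
  have h1 := (Set.ncard_le_ncard hsub (Set.toFinite _)).trans (Finset.set_ncard_biUnion_le _ _)
  have hn : (1 : ℝ) ≤ n := by exact_mod_cast NeZero.one_le
  have h2 : ∀ i ∈ Finset.univ.filter P,
      ((lengthClass i.1 i.2.1 i.2.2.1 i.2.2.2.1 fun c => i.2.2.2.2 c).ncard : ℝ)
        ≤ 2 ^ n * (8 ^ n) ^ (d + 1) * (n : ℝ) ^ (((d : ℝ) + 4) * n / 6) := by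
    intro i hi
    have hle : P i := (Finset.mem_filter.1 hi).2
    refine (Nat.cast_le.2 (ncard_lengthClass_le _ _ _ _ _)).trans ?_
    push_cast
    gcongr
    rw [← Real.rpow_natCast]
    refine Real.rpow_le_rpow_of_exponent_le hn ?_
    rw [le_div_iff₀ (by norm_num), mul_comm]
    exact_mod_cast hle
  calc (numThreePlanar d n : ℝ)
      ≤ ∑ i ∈ Finset.univ.filter P,
        ((lengthClass i.1 i.2.1 i.2.2.1 i.2.2.2.1 fun c => i.2.2.2.2 c).ncard : ℝ) := by
        exact_mod_cast h1
    _ ≤ (Finset.univ.filter P).card *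
        (2 ^ n * (8 ^ n) ^ (d + 1) * (n : ℝ) ^ (((d : ℝ) + 4) * n / 6)) := by
        rw [← nsmul_eq_mul]
        exact Finset.sum_le_card_nsmul _ _ _ h2
    _ ≤ (Fintype.card ι : ℝ) *
        (2 ^ n * (8 ^ n) ^ (d + 1) * (n : ℝ) ^ (((d : ℝ) + 4) * n / 6)) := by
        gcongr
        exact Finset.card_le_univ _
    _ = 2 ^ n * (d + 1) * (d + 1) * ((n + 1 : ℕ) : ℝ) ^ (d + 2) *
        (2 ^ n * (8 ^ n) ^ (d + 1) * (n : ℝ) ^ (((d : ℝ) + 4) * n / 6)) := by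
        simp only [ι, Fintype.card_prod, Fintype.card_fun, Fintype.card_fin, Fintype.card_bool]
        push_cast
        ring
    _ ≤ 2 ^ n * (d + 1) * (d + 1) * ((2 ^ n : ℕ) : ℝ) ^ (d + 2) *
        (2 ^ n * (8 ^ n) ^ (d + 1) * (n : ℝ) ^ (((d : ℝ) + 4) * n / 6)) := by
        gcongr
        exact Nat.lt_two_pow_self
    _ = _ := by
        rw [show (4 : ℝ) = 2 * 2 by norm_num]
        push_cast
        rw [← pow_mul, ← pow_mul, mul_comm n, mul_comm n, pow_mul, pow_mul, mul_pow, mul_pow,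
          mul_pow]
        ring

/-! ### Planarity of explicit graphs -/

namespace ColourfulGraph

variable {n : ℕ}

section

variable (G : ColourfulGraph 2 n) {white : Fin n → Bool} (hw : G.IsBipartition white)

theorem mem_component_iff (x : Fin n × Fin 3) (v : Fin n) (c c' : Fin 3) :
    (v, c) ∈ (G.canonicalEmbedding white hw).component x ↔
      (v, c') ∈ (G.canonicalEmbedding white hw).component x := by
  have := (sameCycle_rot G hw v c c').eq_of_invariant
    (f := fun y => y ∈ (G.canonicalEmbedding white hw).component x)
    fun y => propext (rot_mem_component _)
  exact iff_of_eq this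

theorem nbr_mem_component_iff (x : Fin n × Fin 3) (v : Fin n) (c c' : Fin 3) :
    (G.nbr c v, c') ∈ (G.canonicalEmbedding white hw).component x ↔
      (v, c') ∈ (G.canonicalEmbedding white hw).component x := by
  rw [mem_component_iff G hw x v c' c, mem_component_iff G hw x _ c' c, ← opp_apply G hw,
    opp_mem_component]

/-- A component consists of all half-edges at a set of vertices. -/
theorem component_eq (x : Fin n × Fin 3) :
    (G.canonicalEmbedding white hw).component x
      = {y | y.1 ∈ {v | (v, (0 : Fin 3)) ∈ (G.canonicalEmbedding white hw).component x}} := by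
  ext ⟨v, c⟩
  exact mem_component_iff G hw x v c 0

/-- Doubling the edges of one colour of a `2`-coloured graph gives a planar graph. -/
theorem isPlanar_of_nbr_eq (h12 : G.nbr 1 = G.nbr 2) :
    (G.canonicalEmbedding white hw).IsPlanar := by
  intro x
  set M := G.canonicalEmbedding white hw with hM
  set S := {v | (v, (0 : Fin 3)) ∈ M.component x} with hS
  have hclosed : ∀ c, ∀ v ∈ S, G.nbr c v ∈ S := fun c v hv =>
    (nbr_mem_component_iff G hw x v c 0).2 hv
  have hx : x.1 ∈ S := (mem_component_iff G hw x x.1 0 x.2).2 (M.mem_component_self x)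
  have h1 : G.whitePerm hw 1 2 = 1 := by
    rw [← whitePerm_self G hw 2]
    ext v
    by_cases hv : white v <;> simp [whitePerm, h12]
  have h2 : G.whitePerm hw 2 0 = (G.whitePerm hw 0 1)⁻¹ := by
    rw [whitePerm_inv]
    ext v
    by_cases hv : white v <;> simp [whitePerm, h12]
  set W := S ∩ {v | white v = true} with hW
  have hne : W.Nonempty := by
    by_cases hxw : white x.1
    · exact ⟨x.1, hx, hxw⟩
    · exact ⟨G.nbr 0 x.1, hclosed 0 _ hx, by simpa [hw.white_nbr] using hxw⟩
  have hsame : ∀ u ∈ W, ∀ v ∈ W, (G.whitePerm hw 0 1).SameCycle u v := by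
    let cl : Fin n → Set (Fin n) := fun v => {z | (G.whitePerm hw 0 1).SameCycle v z}
    have hinv : ∀ t v, white v = true → cl (G.nbr 0 (G.nbr t v)) = cl v := fun t v hv => by
        refine setOf_sameCycle_eq_iff.2 ?_
        have h01 : (G.whitePerm hw 0 1).SameCycle (G.nbr 0 (G.nbr 1 v)) v := by
          rw [← whitePerm_of_white G hw 0 1 hv, Perm.sameCycle_apply_left]
        fin_cases t
        · change Perm.SameCycle _ (G.nbr 0 (G.nbr 0 v)) v
          rw [G.nbr_nbr]
        · exact h01
        · change Perm.SameCycle _ (G.nbr 0 (G.nbr 2 v)) v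
          rwa [← h12]
    rintro u ⟨hu, huw⟩ v ⟨hv, hvw⟩
    rw [Set.mem_ofPred_eq] at huw hvw
    have h3 := eq_of_mem_component G hw (f := cl) (β := G.nbr 0) hinv hu
    have h4 := eq_of_mem_component G hw (f := cl) (β := G.nbr 0) hinv hv
    have h5 := h3.trans h4.symm
    simp only [huw, hvw, if_true] at h5
    exact setOf_sameCycle_eq_iff.1 h5
  have e1 : numCycles (G.whitePerm hw 0 1) W = 1 := numCycles_eq_one hne hsame
  have e2 : numCycles (G.whitePerm hw 2 0) W = 1 := by rw [h2, numCycles_inv, e1]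
  have e3 : numCycles (G.whitePerm hw 1 2) W = W.ncard := by
    rw [h1, numCycles_eq_ncard_image (f := id) (by simp), Set.image_id]
  rw [eulerChar_eq hclosed (component_eq G hw x), Fin.sum_univ_three,
    show (0 : Fin 3) - 1 = 2 by decide, show (1 : Fin 3) - 1 = 0 by decide,
    show (2 : Fin 3) - 1 = 1 by decide, e1, e2, e3]
  push_cast
  ring

/-- Planarity of a connected graph. -/
theorem isPlanar_of_connected
    (hconn : ∀ T : Set (Fin n), T.Nonempty → (∀ c v, G.nbr c v ∈ T ↔ v ∈ T) → T = Set.univ)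
    (hF : numCycles (G.whitePerm hw 2 0) {v | white v = true}
        + numCycles (G.whitePerm hw 0 1) {v | white v = true}
        + numCycles (G.whitePerm hw 1 2) {v | white v = true}
      = {v | white v = true}.ncard + 2) :
    (G.canonicalEmbedding white hw).IsPlanar := by
  intro x
  have hS := hconn {v | (v, (0 : Fin 3)) ∈ (G.canonicalEmbedding white hw).component x}
    ⟨x.1, (mem_component_iff G hw x x.1 0 x.2).2 (mem_component_self _ x)⟩
    fun c v => nbr_mem_component_iff G hw x v c 0
  have hx := component_eq G hw x
  rw [hS] at hx
  rw [eulerChar_eq (fun _ _ _ => Set.mem_univ _) hx, Fin.sum_univ_three,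
    show (0 : Fin 3) - 1 = 2 by decide, show (1 : Fin 3) - 1 = 0 by decide,
    show (2 : Fin 3) - 1 = 1 by decide, Set.univ_inter]
  zify at hF
  rw [hF]
  ring

end

end ColourfulGraph

/-! ### Gluing two rings along a permutation -/

/-- The colours `0, 1, 2, 3` on the disjoint union of two rings, glued along the permutation `σ`.

The vertices of the first ring are `(0, i), (1, i), (2, i)`; those of the second one, with the roles
of the colours `0, 1` and `2, 3` and of white and black exchanged, are `(3, i), (4, i), (5, i)`.
Each ring is a prism with a cycle of length `2 * L` as its base, with doubled rungs, from which
every other vertex of one of the two bases has been removed; `σ` says how to join the edges left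
dangling in the first ring to those left dangling in the second one. -/
def gluedNbr {L : ℕ} (σ : Perm (ZMod L)) : Fin 4 → Fin 6 × ZMod L → Fin 6 × ZMod L
  | 0, (0, i) => (5, σ i)
  | 0, (1, i) => (2, i)
  | 0, (2, i) => (1, i)
  | 0, (3, i) => (4, i)
  | 0, (4, i) => (3, i)
  | 0, (5, i) => (0, σ.symm i)
  | 1, (0, i) => (5, σ i - 1)
  | 1, (1, i) => (2, i)
  | 1, (2, i) => (1, i)
  | 1, (3, i) => (4, i - 1)
  | 1, (4, i) => (3, i + 1)
  | 1, (5, i) => (0, σ.symm (i + 1))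
  | 2, (0, i) => (1, i)
  | 2, (1, i) => (0, i)
  | 2, (2, i) => (3, σ i)
  | 2, (3, i) => (2, σ.symm i)
  | 2, (4, i) => (5, i)
  | 2, (5, i) => (4, i)
  | 3, (0, i) => (1, i - 1)
  | 3, (1, i) => (0, i + 1)
  | 3, (2, i) => (3, σ (i + 1))
  | 3, (3, i) => (2, σ.symm i - 1)
  | 3, (4, i) => (5, i)
  | 3, (5, i) => (4, i)

/-- The white vertices of the glued rings. -/
def gluedWhite : Fin 6 → Bool
  | 0 => false
  | 1 => true
  | 2 => false
  | 3 => true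
  | 4 => false
  | 5 => true

section Glued

variable {L : ℕ} (σ : Perm (ZMod L))

theorem gluedNbr_gluedNbr (c : Fin 4) (v : Fin 6 × ZMod L) :
    gluedNbr σ c (gluedNbr σ c v) = v := by
  obtain ⟨k, i⟩ := v
  fin_cases c <;> fin_cases k <;> simp [gluedNbr]

theorem gluedWhite_gluedNbr (c : Fin 4) (v : Fin 6 × ZMod L) :
    gluedWhite (gluedNbr σ c v).1 ≠ gluedWhite v.1 := by
  obtain ⟨k, i⟩ := v
  fin_cases c <;> fin_cases k <;> simp [gluedNbr, gluedWhite]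

theorem ZMod.forall_of_add_one {L : ℕ} [NeZero L] {P : ZMod L → Prop} (h0 : P 0)
    (h : ∀ i, P i → P (i + 1)) (i : ZMod L) : P i := by
  have : ∀ k : ℕ, P (k : ZMod L) := by
    intro k
    induction k with
    | zero => simpa using h0
    | succ k ih => simpa using h _ ih
  simpa using this i.val

/-- Any three colours connect all vertices. -/
theorem gluedNbr_connected [NeZero L] {a b c : Fin 4} (hab : a < b) (hbc : b < c)
    {T : Fin 6 × ZMod L → Prop} (ha : ∀ v, T (gluedNbr σ a v) ↔ T v)
    (hb : ∀ v, T (gluedNbr σ b v) ↔ T v) (hc : ∀ v, T (gluedNbr σ c v) ↔ T v)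
    (v w : Fin 6 × ZMod L) : T v ↔ T w := by
  have hs : ∀ i, σ (σ.symm i) = i := σ.apply_symm_apply
  suffices h : ∃ r : Prop, ∀ k i, T (k, i) ↔ r by
    obtain ⟨r, hr⟩ := h
    exact (hr v.1 v.2).trans (hr w.1 w.2).symm
  have hcases : (a = 0 ∧ b = 1 ∧ (c = 2 ∨ c = 3)) ∨
      ((a = 0 ∨ a = 1) ∧ b = 2 ∧ c = 3) := by
    clear ha hb hc
    revert a b c
    decide
  rcases hcases with ⟨rfl, rfl, hc'⟩ | ⟨ha', rfl, rfl⟩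
  · -- the colours `0, 1` connect the ring of the vertices `3, 4`
    have h34 : ∀ i, T (4, i) ↔ T (3, i) := fun i => ha (3, i)
    have h3 : ∀ i, T (3, i) ↔ T (3, 0) := ZMod.forall_of_add_one Iff.rfl fun i hi =>
      ((hb (4, i)).trans (h34 i)).trans hi
    have h12 : ∀ i, T (1, i) ↔ T (2, i) := fun i => ha (2, i)
    have h05 : ∀ i, T (0, i) ↔ T (5, σ i) := fun i => (ha (0, i)).symm
    have h45 : ∀ i, T (5, i) ↔ T (4, i) := fun i => by
      rcases hc' with rfl | rfl <;> exact hc (4, i)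
    have h2 : ∃ i' : ZMod L → ZMod L, ∀ i, T (2, i) ↔ T (3, i' i) := by
      rcases hc' with rfl | rfl
      · exact ⟨fun i => σ i, fun i => (hc (2, i)).symm⟩
      · exact ⟨fun i => σ (i + 1), fun i => (hc (2, i)).symm⟩
    obtain ⟨i', h2⟩ := h2
    refine ⟨T (3, 0), fun k i => ?_⟩
    fin_cases k
    · exact (h05 i).trans ((h45 _).trans ((h34 _).trans (h3 _)))
    · exact (h12 i).trans ((h2 i).trans (h3 _))
    · exact (h2 i).trans (h3 _)
    · exact h3 i
    · exact (h34 i).trans (h3 i)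
    · exact (h45 i).trans ((h34 _).trans (h3 _))
  · -- the colours `2, 3` connect the ring of the vertices `0, 1`
    have h01 : ∀ i, T (1, i) ↔ T (0, i) := fun i => hb (0, i)
    have h0 : ∀ i, T (0, i) ↔ T (0, 0) := ZMod.forall_of_add_one Iff.rfl fun i hi =>
      ((hc (1, i)).trans (h01 i)).trans hi
    have h45 : ∀ i, T (4, i) ↔ T (5, i) := fun i => hb (5, i)
    have h23 : ∀ i, T (2, i) ↔ T (3, σ i) := fun i => (hb (2, i)).symm
    have h12 : ∀ i, T (2, i) ↔ T (1, i) := fun i => by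
      rcases ha' with rfl | rfl <;> exact ha (1, i)
    have h5 : ∃ i' : ZMod L → ZMod L, ∀ i, T (5, i) ↔ T (0, i' i) := by
      rcases ha' with rfl | rfl
      · exact ⟨fun i => σ.symm i, fun i => (ha (5, i)).symm⟩
      · exact ⟨fun i => σ.symm (i + 1), fun i => (ha (5, i)).symm⟩
    obtain ⟨i', h5⟩ := h5
    have h3 : ∀ i, T (3, i) ↔ T (0, 0) := fun i => by
      have := (h23 (σ.symm i)).symm.trans ((h12 _).trans ((h01 _).trans (h0 _)))
      rwa [hs] at this
    refine ⟨T (0, 0), fun k i => ?_⟩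
    fin_cases k
    · exact h0 i
    · exact (h01 i).trans (h0 i)
    · exact (h12 i).trans ((h01 i).trans (h0 i))
    · exact h3 i
    · exact (h45 i).trans ((h5 i).trans (h0 _))
    · exact (h5 i).trans (h0 _)

theorem ncard_gluedWhite : {v : Fin 6 × ZMod L | gluedWhite v.1 = true}.ncard = 3 * L := by
  have : {v : Fin 6 × ZMod L | gluedWhite v.1 = true}
      = ((({1, 3, 5} : Finset (Fin 6)) : Set (Fin 6)) ×ˢ (Set.univ : Set (ZMod L))) := by
    ext ⟨k, i⟩
    fin_cases k <;> simp [gluedWhite]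
  rw [this, Set.ncard_prod, Set.ncard_coe_finset, Set.ncard_univ, Nat.card_zmod]
  rfl

/-- The step from a white vertex along the edges of colours `b` and `a`. -/
def gluedStep (a b : Fin 4) (v : Fin 6 × ZMod L) : Fin 6 × ZMod L :=
  gluedNbr σ a (gluedNbr σ b v)

variable {d n : ℕ} {G : ColourfulGraph d n} {white : Fin n → Bool} {hw : G.IsBipartition white}
  {σ}

/-- `G` contains, under the labelling `e`, the colours `a` and `b` of the glued rings as its
colours `s` and `t`. -/
structure IsGluedPair (hw : G.IsBipartition white) (σ : Perm (ZMod L)) (e : Fin 6 × ZMod L ≃ Fin n)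
    (s t : Fin (d + 1)) (a b : Fin 4) : Prop where
  white_eq : ∀ v, white (e v) = gluedWhite v.1
  left : ∀ v, G.nbr s (e v) = e (gluedNbr σ a v)
  right : ∀ v, G.nbr t (e v) = e (gluedNbr σ b v)

namespace IsGluedPair

variable {e : Fin 6 × ZMod L ≃ Fin n} {s t : Fin (d + 1)} {a b : Fin 4}

theorem symm (h : IsGluedPair hw σ e s t a b) : IsGluedPair hw σ e t s b a :=
  ⟨h.white_eq, h.right, h.left⟩

theorem whitePerm_apply (h : IsGluedPair hw σ e s t a b) {v : Fin 6 × ZMod L}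
    (hv : gluedWhite v.1 = true) : G.whitePerm hw s t (e v) = e (gluedStep σ a b v) := by
  rw [ColourfulGraph.whitePerm_of_white G hw _ _ ((h.white_eq v).trans hv), h.right, h.left,
    gluedStep]

theorem sameCycle_step (h : IsGluedPair hw σ e s t a b) {v : Fin 6 × ZMod L}
    (hv : gluedWhite v.1 = true) :
    (G.whitePerm hw s t).SameCycle (e v) (e (gluedStep σ a b v)) := by
  rw [← h.whitePerm_apply hv, Perm.sameCycle_apply_right]

/-- Counting the bicoloured cycles by means of representatives `f`. -/
theorem numCycles_eq (h : IsGluedPair hw σ e s t a b) {f : Fin 6 × ZMod L → Fin 6 × ZMod L}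
    (hrep : ∀ v, gluedWhite v.1 = true → (G.whitePerm hw s t).SameCycle (e v) (e (f v)))
    (hinv : ∀ v, gluedWhite v.1 = true → f (gluedStep σ a b v) = f v) :
    numCycles (G.whitePerm hw s t) {v | white v = true}
      = (f '' {v | gluedWhite v.1 = true}).ncard := by
  have hwe : ∀ v, white v = gluedWhite (e.symm v).1 := fun v => by
    rw [← h.white_eq, e.apply_symm_apply]
  rw [numCycles_eq_ncard_image (f := fun v => f (e.symm v))]
  · congr 1
    ext w
    constructor
    · rintro ⟨v, hv, rfl⟩
      exact ⟨e.symm v, by rw [Set.mem_ofPred_eq, ← hwe]; exact hv, rfl⟩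
    · rintro ⟨v, hv, rfl⟩
      exact ⟨e v, (h.white_eq v).trans hv, by simp⟩
  · intro u hu v hv
    rw [Set.mem_ofPred_eq, hwe] at hu hv
    constructor
    · intro huv
      have h1 := hrep _ hu
      have h2 := hrep _ hv
      simp only [e.apply_symm_apply] at h1 h2 huv
      rw [huv] at h1
      exact h1.trans h2.symm
    · intro huv
      have := huv.eq_of_invariant (f := fun v => if white v then some (f (e.symm v)) else none)
        fun v => by
          have hvw := ColourfulGraph.white_whitePerm G hw s t v
          rw [hvw]
          by_cases hv : white v
          · have hv' := hv
            rw [hwe] at hv'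
            have h1 := h.whitePerm_apply hv'
            rw [e.apply_symm_apply] at h1
            simp only [hv, if_true, h1, e.symm_apply_apply, hinv _ hv']
          · simp [hv]
      rw [hwe u, hwe v, hu, hv] at this
      simpa using this

/-- The case of bicoloured hexagons. -/
theorem numCycles_hexagon (h : IsGluedPair hw σ e s t a b)
    (h1 : ∀ i, ∃ j, gluedStep σ a b (1, i) = (5, j))
    (h5 : ∀ i, ∃ j, gluedStep σ a b (5, i) = (3, j))
    (h3 : ∀ i, ∃ j, gluedStep σ a b (3, i) = (1, j))
    (hcyc : ∀ i, gluedStep σ a b (gluedStep σ a b (gluedStep σ a b (1, i))) = (1, i)) :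
    numCycles (G.whitePerm hw s t) {v | white v = true} = L := by
  let f : Fin 6 × ZMod L → Fin 6 × ZMod L := fun v =>
    if v.1 = 1 then v else if v.1 = 3 then gluedStep σ a b v
      else gluedStep σ a b (gluedStep σ a b v)
  have hkind : ∀ v : Fin 6 × ZMod L, gluedWhite v.1 = true →
      (∃ i, v = (1, i)) ∨ (∃ i, v = (3, i)) ∨ ∃ i, v = (5, i) := by
    rintro ⟨k, i⟩ hv
    fin_cases k <;> simp_all [gluedWhite]
  rw [h.numCycles_eq (f := f)]
  · have himg : f '' {v | gluedWhite v.1 = true} = Set.range fun i : ZMod L => ((1 : Fin 6), i) := by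
      ext w
      constructor
      · rintro ⟨v, hv, rfl⟩
        rcases hkind v hv with ⟨i, rfl⟩ | ⟨i, rfl⟩ | ⟨i, rfl⟩
        · exact ⟨i, by simp [f]⟩
        · obtain ⟨j, hj⟩ := h3 i
          exact ⟨j, by simp [f, hj]⟩
        · obtain ⟨j, hj⟩ := h5 i
          obtain ⟨k, hk⟩ := h3 j
          exact ⟨k, by simp [f, hj, hk]⟩
      · rintro ⟨i, rfl⟩
        exact ⟨(1, i), by simp [gluedWhite], by simp [f]⟩
    rw [himg, ← Set.image_univ, Set.ncard_image_of_injective _ (Prod.mk_right_injective _),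
      Set.ncard_univ, Nat.card_zmod]
  · intro v hv
    rcases hkind v hv with ⟨i, rfl⟩ | ⟨i, rfl⟩ | ⟨i, rfl⟩
    · simpa [f] using Perm.SameCycle.refl _ _
    · simpa [f] using h.sameCycle_step hv
    · obtain ⟨j, hj⟩ := h5 i
      have := h.sameCycle_step hv
      rw [hj] at this
      simpa [f, hj] using this.trans (h.sameCycle_step (by simp [gluedWhite]))
  · intro v hv
    rcases hkind v hv with ⟨i, rfl⟩ | ⟨i, rfl⟩ | ⟨i, rfl⟩
    · obtain ⟨j, hj⟩ := h1 i
      have := hcyc i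
      rw [hj] at this
      simp [f, hj, this]
    · obtain ⟨j, hj⟩ := h3 i
      simp [f, hj]
    · obtain ⟨j, hj⟩ := h5 i
      simp [f, hj]

/-- The case where the two rings give one cycle each, the other cycles being double edges. -/
theorem numCycles_ring [NeZero L] (h : IsGluedPair hw σ e s t a b) {k₀ k₁ k₂ : Fin 6}
    (hk : ∀ k, gluedWhite k = true ↔ k = k₀ ∨ k = k₁ ∨ k = k₂)
    (h01 : k₀ ≠ k₁) (h02 : k₀ ≠ k₂) (h12 : k₁ ≠ k₂)
    (hfix : ∀ i, gluedStep σ a b (k₀, i) = (k₀, i))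
    (hk₁ : ∀ i, ∃ j, gluedStep σ a b (k₁, i) = (k₁, j))
    (hk₂ : ∀ i, ∃ j, gluedStep σ a b (k₂, i) = (k₂, j))
    (hr₁ : ∀ i, (G.whitePerm hw s t).SameCycle (e (k₁, i)) (e (k₁, 0)))
    (hr₂ : ∀ i, (G.whitePerm hw s t).SameCycle (e (k₂, i)) (e (k₂, 0))) :
    numCycles (G.whitePerm hw s t) {v | white v = true} = L + 2 := by
  let f : Fin 6 × ZMod L → Fin 6 × ZMod L := fun v => if v.1 = k₀ then v else (v.1, 0)
  have hkind : ∀ v : Fin 6 × ZMod L, gluedWhite v.1 = true →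
      (∃ i, v = (k₀, i)) ∨ (∃ i, v = (k₁, i)) ∨ ∃ i, v = (k₂, i) := by
    rintro ⟨k, i⟩ hv
    rcases (hk k).1 hv with rfl | rfl | rfl
    · exact Or.inl ⟨i, rfl⟩
    · exact Or.inr (Or.inl ⟨i, rfl⟩)
    · exact Or.inr (Or.inr ⟨i, rfl⟩)
  rw [h.numCycles_eq (f := f)]
  · have himg : f '' {v | gluedWhite v.1 = true}
        = (Set.range fun i : ZMod L => (k₀, i)) ∪ {(k₁, 0), (k₂, 0)} := by
      ext w
      constructor
      · rintro ⟨v, hv, rfl⟩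
        rcases hkind v hv with ⟨i, rfl⟩ | ⟨i, rfl⟩ | ⟨i, rfl⟩
        · exact Or.inl ⟨i, by simp [f]⟩
        · right
          simp [f, h01.symm]
        · right
          simp [f, h02.symm]
      · rintro (⟨i, rfl⟩ | rfl | rfl)
        · exact ⟨(k₀, i), (hk _).2 (Or.inl rfl), by simp [f]⟩
        · exact ⟨(k₁, 0), (hk _).2 (Or.inr (Or.inl rfl)), by simp [f]⟩
        · exact ⟨(k₂, 0), (hk _).2 (Or.inr (Or.inr rfl)), by simp [f]⟩
    rw [himg, Set.ncard_union_eq, Set.ncard_pair, ← Set.image_univ,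
      Set.ncard_image_of_injective _ (Prod.mk_right_injective _), Set.ncard_univ, Nat.card_zmod]
    · simp [h12]
    · rw [Set.disjoint_left]
      rintro _ ⟨i, rfl⟩ h'
      simp [h01, h02] at h'
  · intro v hv
    rcases hkind v hv with ⟨i, rfl⟩ | ⟨i, rfl⟩ | ⟨i, rfl⟩
    · simpa [f] using Perm.SameCycle.refl _ _
    · simpa [f, h01.symm] using hr₁ i
    · simpa [f, h02.symm] using hr₂ i
  · intro v hv
    rcases hkind v hv with ⟨i, rfl⟩ | ⟨i, rfl⟩ | ⟨i, rfl⟩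
    · rw [hfix]
    · obtain ⟨j, hj⟩ := hk₁ i
      simp [f, hj, h01.symm]
    · obtain ⟨j, hj⟩ := hk₂ i
      simp [f, hj, h02.symm]

theorem numCycles_zero_one [NeZero L] (h : IsGluedPair hw σ e s t 0 1) :
    numCycles (G.whitePerm hw s t) {v | white v = true} = L + 2 := by
  refine h.numCycles_ring (k₀ := 1) (k₁ := 3) (k₂ := 5) (by decide) (by decide) (by decide)
    (by decide) (fun i => ?_) (fun i => ⟨i - 1, ?_⟩) (fun i => ⟨i + 1, ?_⟩) ?_ ?_
  · simp [gluedStep, gluedNbr]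
  · simp [gluedStep, gluedNbr]
  · simp [gluedStep, gluedNbr]
  · refine ZMod.forall_of_add_one (Perm.SameCycle.refl _ _) fun i hi => ?_
    have := h.sameCycle_step (v := (3, i + 1)) (by simp [gluedWhite])
    simp only [gluedStep, gluedNbr, add_sub_cancel_right] at this
    exact this.trans hi
  · refine ZMod.forall_of_add_one (Perm.SameCycle.refl _ _) fun i hi => ?_
    have := h.sameCycle_step (v := (5, i)) (by simp [gluedWhite])
    simp only [gluedStep, gluedNbr, Equiv.apply_symm_apply] at this
    exact this.symm.trans hi

theorem numCycles_two_three [NeZero L] (h : IsGluedPair hw σ e s t 2 3) :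
    numCycles (G.whitePerm hw s t) {v | white v = true} = L + 2 := by
  refine h.numCycles_ring (k₀ := 5) (k₁ := 1) (k₂ := 3) (by decide) (by decide) (by decide)
    (by decide) (fun i => ?_) (fun i => ⟨i + 1, ?_⟩) (fun i => ⟨σ (σ.symm i - 1), ?_⟩) ?_ ?_
  · simp [gluedStep, gluedNbr]
  · simp [gluedStep, gluedNbr]
  · simp [gluedStep, gluedNbr]
  · refine ZMod.forall_of_add_one (Perm.SameCycle.refl _ _) fun i hi => ?_
    have := h.sameCycle_step (v := (1, i)) (by simp [gluedWhite])
    simp only [gluedStep, gluedNbr] at this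
    exact this.symm.trans hi
  · have key : ∀ i, (G.whitePerm hw s t).SameCycle (e (3, σ i)) (e (3, σ 0)) := by
      refine ZMod.forall_of_add_one (Perm.SameCycle.refl _ _) fun i hi => ?_
      have := h.sameCycle_step (v := (3, σ (i + 1))) (by simp [gluedWhite])
      simp only [gluedStep, gluedNbr, Equiv.symm_apply_apply, add_sub_cancel_right] at this
      exact this.trans hi
    intro i
    have h1 := key (σ.symm i)
    have h2 := key (σ.symm 0)
    rw [Equiv.apply_symm_apply] at h1 h2
    exact h1.trans h2.symm

theorem numCycles_of_le_one_of_two_le (h : IsGluedPair hw σ e s t a b) (ha : a ≤ 1) (hb : 2 ≤ b) :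
    numCycles (G.whitePerm hw s t) {v | white v = true} = L := by
  have ha' : a = 0 ∨ a = 1 := by
    clear h
    revert a
    decide
  have hb' : b = 2 ∨ b = 3 := by
    clear h
    revert b
    decide
  rcases ha' with rfl | rfl <;> rcases hb' with rfl | rfl <;>
    exact h.numCycles_hexagon (by simp [gluedStep, gluedNbr]) (by simp [gluedStep, gluedNbr])
      (by simp [gluedStep, gluedNbr]) (by simp [gluedStep, gluedNbr])

end IsGluedPair

open ColourfulGraph in
/-- Every `3`-coloured subgraph of the glued rings is planar. -/
theorem isPlanar_of_glued [NeZero L] {G : ColourfulGraph 2 n} {hw : G.IsBipartition white}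
    {e : Fin 6 × ZMod L ≃ Fin n} (hwhite : ∀ v, white (e v) = gluedWhite v.1)
    {κ : Fin 3 → Fin 4} (h01 : κ 0 < κ 1) (h12 : κ 1 < κ 2)
    (hnbr : ∀ t v, G.nbr t (e v) = e (gluedNbr σ (κ t) v)) :
    (G.canonicalEmbedding white hw).IsPlanar := by
  have hpair : ∀ s t, IsGluedPair hw σ e s t (κ s) (κ t) := fun s t =>
    ⟨hwhite, hnbr s, hnbr t⟩
  refine isPlanar_of_connected G hw (fun T hT hclosed => ?_) ?_
  · obtain ⟨u, hu⟩ := hT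
    have hcl : ∀ t v, e (gluedNbr σ (κ t) v) ∈ T ↔ e v ∈ T := fun t v => by
      rw [← hnbr, hclosed]
    have := gluedNbr_connected σ (T := fun v => e v ∈ T) h01 h12 (hcl 0) (hcl 1) (hcl 2)
    ext v
    have h1 := this (e.symm u) (e.symm v)
    rw [e.apply_symm_apply, e.apply_symm_apply] at h1
    exact ⟨fun _ => trivial, fun _ => h1.1 hu⟩
  · have hW : {v | white v = true}.ncard = 3 * L := by
      rw [← ncard_gluedWhite (L := L), ← Set.ncard_image_of_injective _ e.injective]
      congr 1
      ext v
      constructor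
      · intro hv
        exact ⟨e.symm v, by rw [Set.mem_ofPred_eq, ← hwhite, e.apply_symm_apply]; exact hv,
          e.apply_symm_apply v⟩
      · rintro ⟨v, hv, rfl⟩
        exact (hwhite v).trans hv
    have p20 := hpair 2 0
    have p01 := hpair 0 1
    have p12 := hpair 1 2
    rw [hW]
    have hcases : (κ 0 = 0 ∧ κ 1 = 1 ∧ 2 ≤ κ 2) ∨ (κ 0 ≤ 1 ∧ κ 1 = 2 ∧ κ 2 = 3) := by
      revert h01 h12
      generalize κ 0 = a
      generalize κ 1 = b
      generalize κ 2 = c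
      revert a b c
      decide
    rw [← numCycles_inv (G.whitePerm hw 2 0), whitePerm_inv]
    rcases hcases with ⟨h0, h1, h2⟩ | ⟨h0, h1, h2⟩
    · rw [p20.symm.numCycles_of_le_one_of_two_le (by rw [h0]; decide) h2,
        p12.numCycles_of_le_one_of_two_le (by rw [h1]) h2]
      rw [h0, h1] at p01
      rw [p01.numCycles_zero_one]
      ring
    · rw [p20.symm.numCycles_of_le_one_of_two_le h0 (by rw [h2]; decide),
        p01.numCycles_of_le_one_of_two_le h0 (by rw [h1])]
      rw [h1, h2] at p12
      rw [p12.numCycles_two_three]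
      ring

end Glued

/-! ### The lower bound -/

/-- The colours of a `(d+1)`-colourful graph, all colours from `3` on being identified. -/
def collapseColour {d : ℕ} (c : Fin (d + 1)) : Fin 4 := ⟨min c 3, by omega⟩

/-- The glued rings, labelled by `e`, as a `(d+1)`-colourful graph in which all edges of colour `3`
are repeated in the higher colours. -/
def gluedGraph (d : ℕ) {L n : ℕ} (σ : Perm (ZMod L)) (e : Fin 6 × ZMod L ≃ Fin n) :
    ColourfulGraph d n where
  nbr c v := e (gluedNbr σ (collapseColour c) (e.symm v))
  nbr_nbr c v := by simp [gluedNbr_gluedNbr]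
  bipartite := ⟨fun v => gluedWhite (e.symm v).1, fun c v => by
    simpa using gluedWhite_gluedNbr σ (collapseColour c) (e.symm v)⟩

/-- Three colours of a `(d+1)`-colourful glued graph are either three distinct colours of the glued
rings, or the last two of them are equal. -/
theorem gluedGraph_isThreePlanar (d : ℕ) {L n : ℕ} [NeZero L] (σ : Perm (ZMod L))
    (e : Fin 6 × ZMod L ≃ Fin n) : (gluedGraph d σ e).IsThreePlanar := by
  have hw : (gluedGraph d σ e).IsBipartition fun v => gluedWhite (e.symm v).1 := fun c v => by
    simpa [gluedGraph] using gluedWhite_gluedNbr σ (collapseColour c) (e.symm v)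
  refine ⟨_, hw, fun I hI => ?_⟩
  let κ : Fin 3 → Fin 4 := fun t => collapseColour (I.orderEmbOfFin hI t)
  have hwI : ((gluedGraph d σ e).restrict I hI).IsBipartition fun v => gluedWhite (e.symm v).1 :=
    fun _ v => hw _ v
  have h01 : I.orderEmbOfFin hI 0 < I.orderEmbOfFin hI 1 :=
    (I.orderEmbOfFin hI).strictMono (by decide)
  have h12 : I.orderEmbOfFin hI 1 < I.orderEmbOfFin hI 2 :=
    (I.orderEmbOfFin hI).strictMono (by decide)
  by_cases h : κ 1 = κ 2
  · exact ColourfulGraph.isPlanar_of_nbr_eq ((gluedGraph d σ e).restrict I hI) hwI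
      (funext fun v => congrArg (fun c => e (gluedNbr σ c (e.symm v))) h)
  · have hκ : κ 0 < κ 1 ∧ κ 1 < κ 2 := by
      simp only [κ, collapseColour, Fin.mk.injEq, Fin.mk_lt_mk] at h ⊢
      rw [Fin.lt_def] at h01 h12
      omega
    exact isPlanar_of_glued (σ := σ) (hw := hwI) (e := e) (κ := κ) (by simp) hκ.1 hκ.2
      fun t v => by simp [ColourfulGraph.restrict, gluedGraph, κ]

/-- A glued graph determines the gluing and the labelling, once the labels of one vertex of each
ring are known: each ring is connected by edges that do not depend on the gluing. -/
theorem gluedGraph_injective {d : ℕ} (hd : 3 ≤ d) {L n : ℕ} [NeZero L] :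
    Function.Injective fun x : Perm (ZMod L) × (Fin 6 × ZMod L ≃ Fin n) =>
      (gluedGraph d x.1 x.2, x.2 (1, 0), x.2 (3, 0)) := by
  rintro ⟨σ, e⟩ ⟨σ', e'⟩ h
  simp only [Prod.mk.injEq] at h
  obtain ⟨hG, h1, h3⟩ := h
  have hnbr : ∀ (c : Fin 4) v, e (gluedNbr σ c (e.symm v)) = e' (gluedNbr σ' c (e'.symm v)) := by
    intro c v
    have h := congrArg (fun G => G.nbr ⟨c, by omega⟩ v) hG
    have hc : collapseColour (d := d) ⟨c, by omega⟩ = c := by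
      simp only [collapseColour, Fin.ext_iff]
      omega
    simpa only [gluedGraph, hc] using h
  have hstep : ∀ (c : Fin 4) v w, gluedNbr σ c v = w → gluedNbr σ' c v = w → e v = e' v →
      e w = e' w := by
    intro c v w hv hv' hev
    have h := hnbr c (e v)
    rw [e.symm_apply_apply, hv] at h
    rw [h, hev, e'.symm_apply_apply, hv']
  have h1' : ∀ i, e (1, i) = e' (1, i) := ZMod.forall_of_add_one h1 fun i hi =>
    hstep 2 (0, i + 1) _ rfl rfl (hstep 3 (1, i) _ rfl rfl hi)
  have h3' : ∀ i, e (3, i) = e' (3, i) := ZMod.forall_of_add_one h3 fun i hi =>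
    hstep 1 (4, i) _ rfl rfl (hstep 0 (3, i) _ rfl rfl hi)
  have h4' : ∀ i, e (4, i) = e' (4, i) := fun i => hstep 0 (3, i) _ rfl rfl (h3' i)
  have hee : e = e' := by
    ext ⟨k, i⟩ : 1
    fin_cases k
    · exact hstep 2 (1, i) _ rfl rfl (h1' i)
    · exact h1' i
    · exact hstep 0 (1, i) _ rfl rfl (h1' i)
    · exact h3' i
    · exact h4' i
    · exact hstep 2 (4, i) _ rfl rfl (h4' i)
  subst hee
  have hσ : σ = σ' := by
    ext i : 1
    have h := hnbr 0 (e (0, i))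
    rw [e.symm_apply_apply] at h
    simpa [gluedNbr] using e.injective h
  rw [hσ]

/-- There are `L !` gluings and `(6 * L)!` labellings. -/
theorem factorial_mul_factorial_le {d : ℕ} (hd : 3 ≤ d) (L : ℕ) [NeZero L] :
    L.factorial * (6 * L).factorial ≤ numThreePlanar d (6 * L) * (6 * L) ^ 2 := by
  classical
  let f : Perm (ZMod L) × (Fin 6 × ZMod L ≃ Fin (6 * L)) →
      {G : ColourfulGraph d (6 * L) | G.IsThreePlanar} × Fin (6 * L) × Fin (6 * L) := fun x =>
    (⟨gluedGraph d x.1 x.2, gluedGraph_isThreePlanar d x.1 x.2⟩, x.2 (1, 0), x.2 (3, 0))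
  have hf : Function.Injective f := by
    intro x y h
    refine gluedGraph_injective hd ?_
    simp only [f, Prod.mk.injEq, Subtype.mk.injEq] at h ⊢
    exact h
  have hcard : Fintype.card (Fin 6 × ZMod L) = Fintype.card (Fin (6 * L)) := by
    simp [ZMod.card]
  have h := Nat.card_le_card_of_injective f hf
  rw [Nat.card_prod, Nat.card_prod, Nat.card_prod, Nat.card_coe_set_eq, Nat.card_perm,
    Nat.card_zmod, Nat.card_eq_fintype_card (α := _ ≃ _),
    Fintype.card_equiv (Fintype.equivOfCardEq hcard), hcard, Nat.card_eq_fintype_card,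
    Fintype.card_fin] at h
  rw [sq]
  exact h

/-! ### Asymptotics -/

theorem tendsto_const_div_log (c : ℝ) :
    Tendsto (fun n : ℕ => c / Real.log n) atTop (nhds 0) :=
  (Real.tendsto_log_atTop.comp tendsto_natCast_atTop_atTop).const_div_atTop c

/-- The crude form `(n / e) ^ n ≤ n !` of Stirling's formula. -/
theorem mul_log_sub_le_log_factorial {n : ℕ} (hn : 1 ≤ n) :
    (n : ℝ) * Real.log n - n ≤ Real.log n.factorial := by
  have hn' : (0 : ℝ) < n := by exact_mod_cast hn
  have hfac : (0 : ℝ) < n.factorial := by exact_mod_cast n.factorial_pos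
  have h := Real.pow_div_factorial_le_exp (n : ℝ) hn'.le n
  have h1 := Real.log_le_log (by positivity) h
  rw [Real.log_div (by positivity) hfac.ne', Real.log_pow, Real.log_exp] at h1
  linarith

theorem le_growthConst {d : ℕ} (hd : 3 ≤ d) : ((1 / 6 : ℝ) : EReal) ≤ growthConst d := by
  have h6 : Tendsto (fun L : ℕ => 6 * L) atTop (atTop ⊓ 𝓟 {n : ℕ | Even n}) := by
    rw [tendsto_inf, tendsto_principal]
    refine ⟨tendsto_id.const_mul_atTop' (by norm_num), Eventually.of_forall fun L => ?_⟩
    exact ⟨3 * L, by ring⟩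
  have hlim0 : Tendsto (fun L : ℕ => 1 / 6 - ((Real.log 6 + 1) / 6) / Real.log (6 * L : ℕ)
      - (1 / 3) / (L : ℝ)) atTop (nhds (1 / 6)) := by
    have h1 := (tendsto_const_div_log ((Real.log 6 + 1) / 6)).comp (h6.mono_right inf_le_left)
    have h2 := (tendsto_natCast_atTop_atTop (R := ℝ)).const_div_atTop (1 / 3)
    simpa only [sub_zero, Function.comp_def] using (h1.const_sub (1 / 6)).sub h2
  have hlim := (continuous_coe_real_ereal.tendsto _).comp hlim0
  rw [← hlim.limsup_eq, growthConst]
  refine le_trans ?_ (limsup_le_limsup_of_le h6)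
  change _ ≤ limsup ((fun n : ℕ => ((Real.log ((numThreePlanar d n : ℝ) / (n.factorial : ℝ))
    / ((n : ℝ) * Real.log n) : ℝ) : EReal)) ∘ fun L => 6 * L) atTop
  refine limsup_le_limsup ?_
  filter_upwards [eventually_ge_atTop 1] with L hL
  have : NeZero L := ⟨by omega⟩
  have hL' : (1 : ℝ) ≤ L := by exact_mod_cast hL
  have hfac : (0 : ℝ) < L.factorial := by exact_mod_cast L.factorial_pos
  have hfac6 : (0 : ℝ) < (6 * L).factorial := by exact_mod_cast (6 * L).factorial_pos
  simp only [Function.comp_apply]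
  rw [EReal.coe_le_coe_iff]
  push_cast
  have hlog : 0 < Real.log (6 * L) := Real.log_pos (by linarith)
  have h1 : Real.log (L.factorial / (6 * L) ^ 2)
      ≤ Real.log (numThreePlanar d (6 * L) / (6 * L).factorial) := by
    refine Real.log_le_log (by positivity) ?_
    rw [div_le_div_iff₀ (by positivity) hfac6]
    exact_mod_cast factorial_mul_factorial_le hd L
  rw [Real.log_div hfac.ne' (by positivity), Real.log_pow] at h1
  have h2 := mul_log_sub_le_log_factorial hL
  have h3 : Real.log (6 * L) = Real.log 6 + Real.log L :=
    Real.log_mul (by norm_num) (by positivity)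
  rw [le_div_iff₀ (by positivity)]
  calc _ = L * (Real.log (6 * L) - Real.log 6) - L - 2 * Real.log (6 * L) := by
        field_simp
        ring
    _ ≤ _ := by
        rw [h3] at h1 ⊢
        push_cast at h1
        linarith

theorem growthConst_le {d : ℕ} (hd : 3 ≤ d) :
    growthConst d ≤ ((((d : ℝ) - 2) / 6 : ℝ) : EReal) := by
  set C : ℝ := (d + 1) ^ 2 with hC
  set K : ℝ := 4 * 8 ^ (d + 1) * 2 ^ (d + 2) with hK
  have hC1 : 1 ≤ C := one_le_pow₀ (by linarith [(Nat.cast_nonneg d : (0 : ℝ) ≤ d)])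
  have hK1 : 1 ≤ K := by
    have h1 : (1 : ℝ) ≤ 8 ^ (d + 1) := one_le_pow₀ (by norm_num)
    have h2 : (1 : ℝ) ≤ 2 ^ (d + 2) := one_le_pow₀ (by norm_num)
    nlinarith
  have hlim0 : Tendsto (fun n : ℕ => ((d : ℝ) - 2) / 6 + (Real.log C + Real.log K + 1)
      / Real.log n) atTop (nhds (((d : ℝ) - 2) / 6)) := by
    simpa using (tendsto_const_div_log (Real.log C + Real.log K + 1)).const_add
      (((d : ℝ) - 2) / 6)
  have hlim := ((continuous_coe_real_ereal.tendsto _).comp hlim0).mono_left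
    (inf_le_left (b := 𝓟 {n : ℕ | Even n}))
  have hne : (atTop ⊓ 𝓟 {n : ℕ | Even n}).NeBot :=
    Filter.inf_principal_neBot_iff.2 fun U hU => by
      obtain ⟨N, hN⟩ := mem_atTop_sets.1 hU
      exact ⟨2 * N, hN _ (by omega), by simp⟩
  rw [← hlim.limsup_eq, growthConst]
  refine limsup_le_limsup ?_
  refine Filter.Eventually.filter_mono inf_le_left ?_
  filter_upwards [eventually_ge_atTop 2] with n hn
  have : NeZero n := ⟨by omega⟩
  have hn' : (2 : ℝ) ≤ n := by exact_mod_cast hn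
  simp only [Function.comp_apply]
  rw [EReal.coe_le_coe_iff]
  have hlog : 0 < Real.log n := Real.log_pos (by linarith)
  have hlogC := Real.log_nonneg hC1
  have hlogK := Real.log_nonneg hK1
  have hd' : (3 : ℝ) ≤ d := by exact_mod_cast hd
  have hfac : (0 : ℝ) < n.factorial := by exact_mod_cast n.factorial_pos
  rcases Nat.eq_zero_or_pos (numThreePlanar d n) with h0 | h0
  · -- the logarithm of `0` is `0`, below the bound
    rw [h0, Nat.cast_zero, zero_div, Real.log_zero, zero_div]
    have : 0 ≤ ((d : ℝ) - 2) / 6 := by linarith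
    positivity
  have hH : (0 : ℝ) < numThreePlanar d n := by exact_mod_cast h0
  have h1 := Real.log_le_log hH (numThreePlanar_le (d := d) (n := n) (by omega))
  rw [← hC, ← hK, Real.log_mul (by positivity) (by positivity),
    Real.log_mul (by positivity) (by positivity), Real.log_pow K n, Real.log_rpow (by linarith)] at h1
  have h2 := mul_log_sub_le_log_factorial (n := n) (by omega)
  rw [Real.log_div hH.ne' hfac.ne', div_le_iff₀ (by positivity)]
  calc Real.log (numThreePlanar d n) - Real.log n.factorial
      ≤ (Real.log C + n * Real.log K + ((d : ℝ) + 4) * n / 6 * Real.log n)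
        - (n * Real.log n - n) := by linarith
    _ ≤ (n * Real.log C + n * Real.log K + ((d : ℝ) + 4) * n / 6 * Real.log n)
        - (n * Real.log n - n) := by
        have : Real.log C ≤ n * Real.log C := le_mul_of_one_le_left hlogC (by linarith)
        linarith
    _ = _ := by
        field_simp
        ring

theorem mainTheorem5 :
    growthConst 3 = ((1 / 6 : ℝ) : EReal) ∧
      ∀ d : ℕ, 4 ≤ d →
        ((1 / 6 : ℝ) : EReal) ≤ growthConst d ∧
          growthConst d ≤ ((((d : ℝ) - 2) / 6 : ℝ) : EReal) := by
  refine ⟨le_antisymm ?_ (le_growthConst le_rfl), fun d hd =>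
    ⟨le_growthConst (by omega), growthConst_le (by omega)⟩⟩
  have := growthConst_le (d := 3) le_rfl
  norm_num at this ⊢
  exact this
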